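/- Let $\mathcal X,\mathcal Y,\mathcal Z$ be finite nonempty sets. A DM-MAC is a stochastic matrix $W:\mathcal X\times\mathcal Y\to\mathcal Z$, with $W^n(\mathbf z|\mathbf x,\mathbf y)=\prod_{t=1}^n W(z_t|x_t,y_t)$. An $(n,M_X,M_Y)$ code $\mathcal C$ consists of codewords $\mathbf x_i\in\mathcal X^n$ ($1\le i\le M_X$), $\mathbf y_j\in\mathcal Y^n$ ($1\le j\le M_Y$), not necessarily distinct, and pairwise disjoint decoding sets $D_{ij}\subseteq\mathcal Z^n$. Its average error probability is $$e(\mathcal C,W)=\frac1{M_XM_Y}\sum_{i,j}W^n(D_{ij}^c|\mathbf x_i,\mathbf y_j).$$ All logarithms and exponentials are natural. The sphere-packing exponent for the maximal error probability is $$E^m_{sp}(R_X,R_Y,W)=\sup_{P_{UXY}}\ \inf_{V}\ \sum_{x,y}P_{XY}(x,y)\,D\big(V(\cdot|x,y)\,\|\,W(\cdot|x,y)\big)\in[0,\infty],$$ where $D$ is relative entropy, the supremum is over all finite alphabets $\mathcal U$ and all distributions $P_{UXY}$ on $\mathcal U\times\mathcal X\times\mathcal Y$ for which $X-U-Y$ is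 a Markov chain, and the infimum is over all stochastic matrices $V:\mathcal X\times\mathcal Y\to\mathcal Z$ such that, for $(U,X,Y,Z)$ distributed according to $P_{UXY}(u,x,y)V(z|x,y)$, at least one of $$I(X\wedge Z\,|\,Y,U)\le R_X,\qquad I(Y\wedge Z\,|\,X,U)\le R_Y,\qquad I(XY\wedge Z\,|\,U)\le R_X+R_Y$$ holds. Theorem. For all finite nonempty $\mathcal X,\mathcal Y,\mathcal Z$ and all $R_X,R_Y,\delta>0$ there is $n_0$ such that, for every DM-MAC $W:\mathcal X\times\mathcal Y\to\mathcal Z$ and every $n\ge n_0$, every $(n,M_X,M_Y)$ code $\mathcal C$ with $$\frac1n\log M_X\ge R_X+\delta,\qquad \frac1n\log M_Y\ge R_Y+\delta$$ satisfies $$e(\mathcal C,W)\ \ge\ \tfrac12\exp\Big(-n\big(E^m_{sp}(R_X,R_Y,W)+\min\{R_X,R_Y\}\big)(1+\delta)\Big),$$ the right-hand side being $0$ when $E^m_{sp}(R_X,R_Y,W)=\infty$. -/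

import Mathlib

namespace MAC

noncomputable section

/-- `W` is a two-input channel with input alphabets `X`, `Y` and output alphabet `Z`, i.e. a
stochastic matrix: for all inputs `x`, `y`, the row `W x y` is a probability distribution on `Z`. -/
def IsChannel {X Y Z : Type*} [Fintype Z] (W : X → Y → Z → ℝ) : Prop :=
  ∀ x y, W x y ∈ stdSimplex ℝ Z

/-- The memoryless extension `W^n(z | x, y) = ∏ₜ W(zₜ | xₜ, yₜ)`. -/
def blockProb {X Y Z : Type*} {n : ℕ} (W : X → Y → Z → ℝ)
    (x : Fin n → X) (y : Fin n → Y) (z : Fin n → Z) : ℝ :=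
  ∏ t, W (x t) (y t) (z t)

/-- `W^n(B | x, y)` for a set `B` of output sequences. -/
def blockProbSet {X Y Z : Type*} [Fintype Z] {n : ℕ} (W : X → Y → Z → ℝ)
    (x : Fin n → X) (y : Fin n → Y) (B : Set (Fin n → Z)) : ℝ :=
  ∑ z, B.indicator (blockProb W x y) z

/-- An `(n, M, N)` multi-user code: codewords `xᵢ ∈ Xⁿ`, `yⱼ ∈ Yⁿ` (repetitions are allowed) and
pairwise disjoint decoding sets `Dᵢⱼ ⊆ Zⁿ`. -/
structure Code (X Y Z : Type*) (n M N : ℕ) where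
  cwX : Fin M → Fin n → X
  cwY : Fin N → Fin n → Y
  dec : Fin M → Fin N → Set (Fin n → Z)
  dec_disjoint : ∀ i j i' j', (i, j) ≠ (i', j') → Disjoint (dec i j) (dec i' j')

/-- The average error probability of a code for the channel `W`. -/
def Code.avgError {X Y Z : Type*} [Fintype Z] {n M N : ℕ} (C : Code X Y Z n M N)
    (W : X → Y → Z → ℝ) : ℝ :=
  1 / ((M : ℝ) * (N : ℝ)) *
    ∑ i, ∑ j, blockProbSet W (C.cwX i) (C.cwY j) (C.dec i j)ᶜ

open Classical in
/-- The relative entropy `D(P ‖ Q) = ∑ₐ P(a) log (P(a) / Q(a))` (natural logarithm) of two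
probability distributions on a finite set; it is `∞` when `P` charges a point that `Q` does not. -/
def relEntropy {A : Type*} [Fintype A] (P Q : A → ℝ) : ENNReal :=
  if ∀ a, Q a = 0 → P a = 0 then ENNReal.ofReal (∑ a, P a * Real.log (P a / Q a)) else ⊤

/-- The conditional divergence `D(V ‖ W | P_XY) = ∑ P_XY(x, y) D(V(· | x, y) ‖ W(· | x, y))`. -/
def condDivergence {X Y Z : Type*} [Fintype X] [Fintype Y] [Fintype Z]
    (V W : X → Y → Z → ℝ) (P : X → Y → ℝ) : ENNReal :=
  ∑ x, ∑ y, ENNReal.ofReal (P x y) * relEntropy (V x y) (W x y)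

/-- The conditional mutual information `I(A ∧ B | C)` (in nats) of a triple of finite random
variables with joint probability mass function `q`. -/
def condMutualInfo {A B C : Type*} [Fintype A] [Fintype B] [Fintype C]
    (q : A → B → C → ℝ) : ℝ :=
  ∑ a, ∑ b, ∑ c, q a b c *
    Real.log ((q a b c * ∑ a', ∑ b', q a' b' c) / ((∑ b', q a b' c) * ∑ a', q a' b c))

/-- The Markov chain condition `X - U - Y` for a joint distribution `P_UXY`:
`P(u, x, y) P(u) = P(u, x) P(u, y)`. -/
def IsMarkov {U X Y : Type*} [Fintype X] [Fintype Y] (P : U × X × Y → ℝ) : Prop :=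
  ∀ u x y, P (u, x, y) * ∑ x', ∑ y', P (u, x', y') =
    (∑ y', P (u, x, y')) * ∑ x', P (u, x', y)

/-- `V_{Z|XY}` satisfies at least one of
`I_V(X ∧ Z | Y U) ≤ R_X`, `I_V(Y ∧ Z | X U) ≤ R_Y`, `I_V(X Y ∧ Z | U) ≤ R_X + R_Y`, the joint
distribution of `(U, X, Y, Z)` being `P(u, x, y) V(z | x, y)`. -/
def MeetsRateCondition {U X Y Z : Type*} [Fintype U] [Fintype X] [Fintype Y] [Fintype Z]
    (RX RY : ℝ) (P : U × X × Y → ℝ) (V : X → Y → Z → ℝ) : Prop :=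
  condMutualInfo (fun (x : X) (z : Z) (c : Y × U) => P (c.2, x, c.1) * V x c.1 z) ≤ RX ∨
  condMutualInfo (fun (y : Y) (z : Z) (c : X × U) => P (c.2, c.1, y) * V c.1 y z) ≤ RY ∨
  condMutualInfo (fun (a : X × Y) (z : Z) (u : U) => P (u, a.1, a.2) * V a.1 a.2 z) ≤ RX + RY

/-- The sphere-packing exponent for the maximal error probability,
`E^m_sp(R_X, R_Y, W) = max_{P_UXY : X - U - Y} min_{V_{Z|XY}} D(V ‖ W | P_XY)`, the minimum being
over the channels `V` that satisfy `MeetsRateCondition RX RY P V`, and `U` ranging over all finite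
alphabets (of arbitrary size). The value may be `∞`. -/
def maxErrorSpherePackingExponent {X Y Z : Type*} [Fintype X] [Fintype Y] [Fintype Z]
    (RX RY : ℝ) (W : X → Y → Z → ℝ) : ENNReal :=
  ⨆ (k : ℕ) (P : Fin k × X × Y → ℝ) (_ : P ∈ stdSimplex ℝ (Fin k × X × Y)) (_ : IsMarkov P),
    ⨅ (V : X → Y → Z → ℝ) (_ : IsChannel V) (_ : MeetsRateCondition RX RY P V),
      condDivergence V W (fun x y => ∑ u, P (u, x, y))

end

end MAC

/-!
Suppose that every pair from a rectangle of about `exp (n RX)` by `exp (n RY)` codewords had error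
probability below `exp (-n (E + δ) (1 + δ))`. Refine a time-sharing sequence `u` by one `Y`-codeword
at a time as long as this raises the mean square of the conditional type of `x` given `u`
noticeably. This stops after a bounded number of steps, and Pythagoras then says that for most pairs
the joint type with `u` is almost a Markov chain `X - U - Y`; by pigeonhole, many of these pairs
share one type `T`. The Markov approximation of `T` is admissible in the supremum that defines `E`,
hence comes with a test channel `V` that meets a rate condition and has divergence at most about `E`
from `W`. By change of measure the pairs of type `T` are decoded with a probability bounded away
from zero when the channel is `V`, and the strong converse for `V` says that there are too many of
them.

Thus every such rectangle contains a bad pair. Cutting the codewords of the smaller rate into blocks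
of about `exp (n min {RX, RY})` shows that a fraction `exp (-n min {RX, RY})` of all pairs is bad,
which bounds the average error probability.
-/

namespace MAC

open Finset Filter

/-! ### Relative entropy and change of measure -/

section Divergence

variable {Ω : Type*} [Fintype Ω] {p q : Ω → ℝ}

/-- The total weight that `p` gives to the points of `S`; thus `blockProbSet W x y S` is
`mass (blockProb W x y) S`. -/
noncomputable def mass (p : Ω → ℝ) (S : Set Ω) : ℝ :=
  ∑ ω, S.indicator p ω

/-- The real-valued relative entropy, which agrees with `relEntropy` when `p` is absolutely
continuous with respect to `q`. Where `p` charges a zero of `q`, division by zero makes the summand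
vanish, so absolute continuity is a separate hypothesis throughout. -/
noncomputable def kl (p q : Ω → ℝ) : ℝ :=
  ∑ ω, p ω * Real.log (p ω / q ω)

theorem mass_nonneg (hp : ∀ ω, 0 ≤ p ω) (S : Set Ω) : 0 ≤ mass p S :=
  sum_nonneg fun ω _ => Set.indicator_nonneg (fun ω _ => hp ω) ω

theorem mass_add_mass_compl (p : Ω → ℝ) (S : Set Ω) : mass p S + mass p Sᶜ = ∑ ω, p ω := by
  simp only [mass, ← sum_add_distrib, Set.indicator_self_add_compl_apply]

theorem sum_mass_le {ι : Type*} (hp : ∀ ω, 0 ≤ p ω) {G : Finset ι} {D : ι → Set Ω}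
    (hD : (G : Set ι).PairwiseDisjoint D) : ∑ i ∈ G, mass p (D i) ≤ ∑ ω, p ω := by
  simp only [mass]
  rw [sum_comm]
  refine sum_le_sum fun ω _ => ?_
  rw [← congrFun (Finset.indicator_biUnion G D hD) ω]
  exact Set.indicator_le_self' (fun _ _ => hp _) ω

theorem kl_self (p : Ω → ℝ) : kl p p = 0 := by
  refine sum_eq_zero fun ω _ => ?_
  rcases eq_or_ne (p ω) 0 with h | h <;> simp [h]

theorem sub_le_mul_log_div {a b : ℝ} (ha : 0 ≤ a) (hb : 0 ≤ b) (hab : b = 0 → a = 0) :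
    a - b ≤ a * Real.log (a / b) := by
  rcases hb.eq_or_lt with rfl | hb
  · simp [hab rfl]
  have h := mul_nonneg hb.le (InformationTheory.klFun_nonneg (div_nonneg ha hb.le))
  have hklFun : b * InformationTheory.klFun (a / b) = a * Real.log (a / b) + b - a := by
    unfold InformationTheory.klFun
    field_simp
  linarith

theorem kl_nonneg (hp : ∀ ω, 0 ≤ p ω) (hq : ∀ ω, 0 ≤ q ω) (hqp : ∑ ω, q ω ≤ ∑ ω, p ω)
    (hac : ∀ ω, q ω = 0 → p ω = 0) : 0 ≤ kl p q := by
  have h := sum_le_sum fun ω (_ : ω ∈ univ) => sub_le_mul_log_div (hp ω) (hq ω) (hac ω)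
  rw [sum_sub_distrib] at h
  exact (sub_nonneg.2 hqp).trans h

theorem kl_le_log_inv (hp : p ∈ stdSimplex ℝ Ω) {c : ℝ} (hc : 0 < c) (hq : ∀ ω, c ≤ q ω) :
    kl p q ≤ Real.log c⁻¹ := by
  have hterm : ∀ ω, p ω * Real.log (p ω / q ω) ≤ p ω * Real.log c⁻¹ := by
    intro ω
    rcases (hp.1 ω).eq_or_lt with h0 | h0
    · simp [← h0]
    have hle : p ω / q ω ≤ c⁻¹ := by
      rw [← one_div]
      exact div_le_div₀ zero_le_one (mem_Icc_of_mem_stdSimplex hp ω).2 hc (hq ω)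
    exact mul_le_mul_of_nonneg_left
      (Real.log_le_log (div_pos h0 (hc.trans_le (hq ω))) hle) h0.le
  refine (sum_le_sum fun ω _ => hterm ω).trans_eq ?_
  rw [← sum_mul, hp.2, one_mul]

/-- The Donsker–Varadhan inequality: `p` has nonnegative divergence from `q` tilted by `exp f`. -/
theorem sum_mul_le_kl_add_log_sum_mul_exp (hp : p ∈ stdSimplex ℝ Ω) (hq : ∀ ω, 0 ≤ q ω)
    (hac : ∀ ω, q ω = 0 → p ω = 0) (f : Ω → ℝ) :
    ∑ ω, p ω * f ω ≤ kl p q + Real.log (∑ ω, q ω * Real.exp (f ω)) := by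
  set M := ∑ ω, q ω * Real.exp (f ω) with hM
  have hterm_nonneg : ∀ ω, 0 ≤ q ω * Real.exp (f ω) := fun ω =>
    mul_nonneg (hq ω) (Real.exp_pos _).le
  have hM_pos : 0 < M := by
    refine (sum_nonneg fun ω _ => hterm_nonneg ω).lt_of_ne fun h0 => one_ne_zero (α := ℝ) ?_
    rw [← hp.2]
    refine sum_eq_zero fun ω hω => hac ω ?_
    have := (sum_eq_zero_iff_of_nonneg fun ω _ => hterm_nonneg ω).1 h0.symm ω hω
    simpa [Real.exp_ne_zero] using this
  have hq_sum : ∑ ω, q ω * Real.exp (f ω) / M = 1 := by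
    rw [← sum_div, ← hM, div_self hM_pos.ne']
  have htilt := kl_nonneg (q := fun ω => q ω * Real.exp (f ω) / M) hp.1
    (fun ω => div_nonneg (hterm_nonneg ω) hM_pos.le) (by rw [hq_sum, hp.2])
    (fun ω h => hac ω (by simpa [hM_pos.ne', Real.exp_ne_zero] using h))
  have hlog : ∀ ω, p ω * Real.log (p ω / (q ω * Real.exp (f ω) / M)) =
      p ω * Real.log (p ω / q ω) - p ω * f ω + p ω * Real.log M := by
    intro ω
    rcases eq_or_ne (p ω) 0 with h | h
    · simp [h]
    have hqω : q ω ≠ 0 := mt (hac ω) h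
    rw [Real.log_div h (by positivity), Real.log_div (by positivity) hM_pos.ne',
      Real.log_mul hqω (Real.exp_ne_zero _), Real.log_exp, Real.log_div h hqω]
    ring
  simp only [kl, hlog, sum_add_distrib, sum_sub_distrib, ← sum_mul, hp.2, one_mul] at htilt
  unfold kl
  linarith

theorem mul_mass_le_kl_add_log_two (hp : p ∈ stdSimplex ℝ Ω) (hq : q ∈ stdSimplex ℝ Ω)
    (hac : ∀ ω, q ω = 0 → p ω = 0) {S : Set Ω} {a : ℝ} (hS : mass q S * Real.exp a ≤ 1) :
    a * mass p S ≤ kl p q + Real.log 2 := by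
  classical
  have hleft : a * mass p S = ∑ ω, p ω * S.indicator (fun _ => a) ω := by
    simp only [mass, mul_comm a, sum_mul, Set.indicator_apply, ite_mul, mul_ite, zero_mul, mul_zero]
  have hterm : ∀ ω, q ω * Real.exp (S.indicator (fun _ => a) ω) ≤
      q ω + S.indicator q ω * Real.exp a := by
    intro ω
    have := hq.1 ω
    by_cases h : ω ∈ S <;> simp [h, this]
  have htwo : ∑ ω, q ω * Real.exp (S.indicator (fun _ => a) ω) ≤ 2 := by
    refine (sum_le_sum fun ω _ => hterm ω).trans ?_
    rw [sum_add_distrib, ← sum_mul, hq.2]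
    exact (add_le_add_right hS 1).trans_eq one_add_one_eq_two
  have hlog : Real.log (∑ ω, q ω * Real.exp (S.indicator (fun _ => a) ω)) ≤ Real.log 2 := by
    rcases (sum_nonneg fun ω _ => mul_nonneg (hq.1 ω) (Real.exp_pos _).le :
      0 ≤ ∑ ω, q ω * Real.exp (S.indicator (fun _ => a) ω)).eq_or_lt with h | h
    · rw [← h, Real.log_zero]
      positivity
    · exact Real.log_le_log h htwo
  rw [hleft]
  exact (sum_mul_le_kl_add_log_sum_mul_exp hp hq.1 hac _).trans (add_le_add_right hlog _)

theorem le_mass_of_mass_compl_mul_exp_le_one (hp : p ∈ stdSimplex ℝ Ω) (hq : q ∈ stdSimplex ℝ Ω)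
    (hac : ∀ ω, q ω = 0 → p ω = 0) {S : Set Ω} {a ε : ℝ} (ha : 0 < a)
    (hS : mass q Sᶜ * Real.exp a ≤ 1) (hkl : kl p q + Real.log 2 ≤ a * (1 - ε)) :
    ε ≤ mass p S := by
  have hcompl := le_of_mul_le_mul_left ((mul_mass_le_kl_add_log_two hp hq hac hS).trans hkl) ha
  linarith [mass_add_mass_compl p S, hp.2]

/-- The last term is the Chernoff bound on the event that the log-likelihood ratio exceeds `κ`; off
that event `p` is at most `exp κ * q`. -/
theorem mass_le_exp_mul_mass_add (hp : ∀ ω, 0 ≤ p ω) (hq : ∀ ω, 0 < q ω) {s : ℝ} (hs : 0 ≤ s)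
    (κ : ℝ) (S : Set Ω) :
    mass p S ≤ Real.exp κ * mass q S +
      Real.exp (-(s * κ)) * ∑ ω, p ω * Real.exp (s * Real.log (p ω / q ω)) := by
  simp only [mass, mul_sum, ← sum_add_distrib]
  refine sum_le_sum fun ω _ => ?_
  have htail : 0 ≤ Real.exp (-(s * κ)) * (p ω * Real.exp (s * Real.log (p ω / q ω))) :=
    mul_nonneg (Real.exp_pos _).le (mul_nonneg (hp ω) (Real.exp_pos _).le)
  by_cases hω : ω ∈ S
  swap
  · simpa [hω] using htail
  simp only [hω, Set.indicator_of_mem]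
  rcases le_or_gt (p ω) (Real.exp κ * q ω) with h | h
  · linarith
  have hpω : 0 < p ω := (mul_pos (Real.exp_pos κ) (hq ω)).trans h
  have hκ : κ ≤ Real.log (p ω / q ω) := by
    rw [Real.le_log_iff_exp_le (div_pos hpω (hq ω)), le_div_iff₀ (hq ω)]
    exact h.le
  have hweight : 1 ≤ Real.exp (-(s * κ)) * Real.exp (s * Real.log (p ω / q ω)) := by
    rw [← Real.exp_add]
    exact Real.one_le_exp (by nlinarith)
  have := mul_pos (Real.exp_pos κ) (hq ω)
  nlinarith

end Divergence

/-! ### Product distributions -/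

section Product

variable {τ Z : Type*} [Fintype τ] {V Q : τ → Z → ℝ}

/-- The product of the weights `V t`, of which `blockProb` is an instance. -/
noncomputable def prodProb (V : τ → Z → ℝ) (z : τ → Z) : ℝ :=
  ∏ t, V t (z t)

theorem prodProb_nonneg (hV : ∀ t a, 0 ≤ V t a) (z : τ → Z) : 0 ≤ prodProb V z :=
  prod_nonneg fun t _ => hV t (z t)

theorem prodProb_pos (hV : ∀ t a, 0 < V t a) (z : τ → Z) : 0 < prodProb V z :=
  prod_pos fun t _ => hV t (z t)

theorem prodProb_ne_zero {z : τ → Z} : prodProb V z ≠ 0 ↔ ∀ t, V t (z t) ≠ 0 := by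
  simp [prodProb, prod_ne_zero_iff]

theorem log_prodProb_div_prodProb {z : τ → Z} (hV : ∀ t, V t (z t) ≠ 0)
    (hQ : ∀ t, Q t (z t) ≠ 0) :
    Real.log (prodProb V z / prodProb Q z) = ∑ t, Real.log (V t (z t) / Q t (z t)) := by
  rw [prodProb, prodProb, ← prod_div_distrib, Real.log_prod fun t _ => div_ne_zero (hV t) (hQ t)]

variable [DecidableEq τ] [Fintype Z]

theorem sum_prodProb (V : τ → Z → ℝ) : ∑ z, prodProb V z = ∏ t, ∑ a, V t a :=
  (Fintype.prod_sum V).symm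

theorem prodProb_mem_stdSimplex (hV : ∀ t, V t ∈ stdSimplex ℝ Z) :
    prodProb V ∈ stdSimplex ℝ (τ → Z) :=
  ⟨prodProb_nonneg fun t => (hV t).1, by simp [sum_prodProb, (hV _).2]⟩

theorem sum_prodProb_mul_sum (hV : ∀ t, ∑ a, V t a = 1) (f : τ → Z → ℝ) :
    ∑ z, prodProb V z * ∑ t, f t (z t) = ∑ t, ∑ a, V t a * f t a := by
  simp_rw [mul_sum]
  rw [sum_comm]
  refine sum_congr rfl fun t _ => ?_
  have hupdate : ∀ z, prodProb V z * f t (z t) =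
      prodProb (Function.update V t fun a => V t a * f t a) z := by
    intro z
    simp only [prodProb]
    rw [← mul_prod_erase univ _ (mem_univ t), ← mul_prod_erase univ _ (mem_univ t),
      Function.update_self, mul_right_comm]
    congr 1
    exact prod_congr rfl fun s hs => by rw [Function.update_of_ne (ne_of_mem_erase hs)]
  simp_rw [hupdate]
  rw [sum_prodProb, ← mul_prod_erase univ _ (mem_univ t), Function.update_self]
  rw [prod_eq_one fun s hs => by rw [Function.update_of_ne (ne_of_mem_erase hs), hV s], mul_one]

theorem kl_prodProb (hV : ∀ t, ∑ a, V t a = 1) (hac : ∀ t a, Q t a = 0 → V t a = 0) :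
    kl (prodProb V) (prodProb Q) = ∑ t, kl (V t) (Q t) := by
  unfold kl
  rw [← sum_prodProb_mul_sum hV fun t a => Real.log (V t a / Q t a)]
  refine sum_congr rfl fun z _ => ?_
  rcases eq_or_ne (prodProb V z) 0 with h | h
  · simp [h]
  have hz := prodProb_ne_zero.1 h
  rw [log_prodProb_div_prodProb hz fun t => mt (hac t _) (hz t)]

theorem sum_prodProb_mul_exp_log_div (hQ : ∀ t a, 0 < Q t a) (s : ℝ) :
    ∑ z, prodProb V z * Real.exp (s * Real.log (prodProb V z / prodProb Q z)) =
      ∏ t, ∑ a, V t a * Real.exp (s * Real.log (V t a / Q t a)) := by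
  rw [← sum_prodProb]
  refine sum_congr rfl fun z _ => ?_
  rw [prodProb.eq_1 fun t a => V t a * Real.exp (s * Real.log (V t a / Q t a)),
    prod_mul_distrib, ← Real.exp_sum, ← mul_sum]
  change _ = prodProb V z * _
  rcases eq_or_ne (prodProb V z) 0 with h | h
  · simp [h]
  rw [log_prodProb_div_prodProb (prodProb_ne_zero.1 h) fun t => (hQ t _).ne']

end Product

/-! ### The strong converse -/

section StrongConverse

variable {Z : Type*} [Fintype Z]

theorem exp_le_one_add_add_sq {x : ℝ} (hx : x ≤ 1) : Real.exp x ≤ 1 + x + x ^ 2 := by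
  rcases le_total (-1) x with h | h
  · have := Real.abs_exp_sub_one_sub_id_le (abs_le.2 ⟨h, hx⟩)
    linarith [le_abs_self (Real.exp x - 1 - x)]
  · have : Real.exp x ≤ 1 := Real.exp_le_one_iff.2 (by linarith)
    nlinarith

theorem mul_log_sq_le_four {r : ℝ} (hr : 0 < r) (hr1 : r ≤ 1) : r * Real.log r ^ 2 ≤ 4 := by
  have h := Real.abs_log_mul_self_rpow_lt r (1 / 2) hr hr1 (by norm_num)
  have hsq := pow_le_pow_left₀ (abs_nonneg _) h.le 2
  rw [sq_abs, mul_pow, ← Real.sqrt_eq_rpow, Real.sq_sqrt hr.le] at hsq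
  linarith

theorem mul_log_div_sq_le {v q L : ℝ} (hv : 0 < v) (hv1 : v ≤ 1) (hq : 0 < q) (hq1 : q ≤ 1)
    (hL : Real.log (v / q) ≤ L) : v * Real.log (v / q) ^ 2 ≤ 4 + L ^ 2 := by
  have hr : 0 < v / q := div_pos hv hq
  rcases le_total 1 (v / q) with h | h
  · have := pow_le_pow_left₀ (Real.log_nonneg h) hL 2
    nlinarith [sq_nonneg (Real.log (v / q))]
  · calc v * Real.log (v / q) ^ 2 = q * (v / q * Real.log (v / q) ^ 2) := by field_simp
      _ ≤ q * 4 := mul_le_mul_of_nonneg_left (mul_log_sq_le_four hr h) hq.le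
      _ ≤ 4 + L ^ 2 := by nlinarith [sq_nonneg L]

theorem sum_mul_exp_log_div_le {v q : Z → ℝ} (hv : v ∈ stdSimplex ℝ Z) {c : ℝ} (hc : 0 < c)
    (hcq : ∀ z, c ≤ q z) (hq : ∑ z, q z ≤ 1) {s : ℝ} (hs : 0 ≤ s) (hsc : s * Real.log c⁻¹ ≤ 1) :
    ∑ z, v z * Real.exp (s * Real.log (v z / q z)) ≤
      Real.exp (s * kl v q + s ^ 2 * (Fintype.card Z * (4 + Real.log c⁻¹ ^ 2))) := by
  have hq0 : ∀ z, 0 < q z := fun z => hc.trans_le (hcq z)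
  have hq1 : ∀ z, q z ≤ 1 := fun z =>
    (single_le_sum (fun a _ => (hq0 a).le) (mem_univ z)).trans hq
  have hterm : ∀ z, v z * Real.exp (s * Real.log (v z / q z)) ≤
      v z + s * (v z * Real.log (v z / q z)) + s ^ 2 * (4 + Real.log c⁻¹ ^ 2) := by
    intro z
    rcases (hv.1 z).eq_or_lt with h0 | h0
    · rw [← h0]
      simp only [zero_mul, mul_zero, zero_add]
      positivity
    have hv1 : v z ≤ 1 := (mem_Icc_of_mem_stdSimplex hv z).2
    have hlog : Real.log (v z / q z) ≤ Real.log c⁻¹ := by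
      refine Real.log_le_log (div_pos h0 (hq0 z)) ?_
      rw [← one_div]
      exact div_le_div₀ zero_le_one hv1 hc (hcq z)
    have hexp := mul_le_mul_of_nonneg_left
      (exp_le_one_add_add_sq ((mul_le_mul_of_nonneg_left hlog hs).trans hsc)) h0.le
    have hsq := mul_le_mul_of_nonneg_left
      (mul_log_div_sq_le h0 hv1 (hq0 z) (hq1 z) hlog) (sq_nonneg s)
    nlinarith
  refine (sum_le_sum fun z _ => hterm z).trans (le_trans (le_of_eq ?_) (Real.add_one_le_exp _))
  rw [sum_add_distrib, sum_add_distrib, ← mul_sum, hv.2, sum_const, card_univ, nsmul_eq_mul]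
  unfold kl
  ring

variable {n : ℕ}

theorem mass_prodProb_le {V Q : Fin n → Z → ℝ} (hV : ∀ t, V t ∈ stdSimplex ℝ Z) {c : ℝ}
    (hc : 0 < c) (hcQ : ∀ t z, c ≤ Q t z) (hQ : ∀ t, ∑ z, Q t z ≤ 1) {s : ℝ} (hs : 0 ≤ s)
    (hsc : s * Real.log c⁻¹ ≤ 1) (κ : ℝ) (S : Set (Fin n → Z)) :
    mass (prodProb V) S ≤ Real.exp κ * mass (prodProb Q) S +
      Real.exp (s * (∑ t, kl (V t) (Q t) - κ) +
        n * (s ^ 2 * (Fintype.card Z * (4 + Real.log c⁻¹ ^ 2)))) := by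
  have hQ0 : ∀ t z, 0 < Q t z := fun t z => hc.trans_le (hcQ t z)
  refine (mass_le_exp_mul_mass_add (prodProb_mem_stdSimplex hV).1
    (prodProb_pos hQ0) hs κ S).trans (add_le_add_right ?_ _)
  have hmoment := prod_le_prod (s := univ) (fun t _ => sum_nonneg fun a _ =>
    mul_nonneg ((hV t).1 a) (Real.exp_pos _).le) fun t _ =>
    sum_mul_exp_log_div_le (hV t) hc (hcQ t) (hQ t) hs hsc
  rw [← Real.exp_sum, sum_add_distrib, ← mul_sum, sum_const, card_univ, Fintype.card_fin,
    nsmul_eq_mul] at hmoment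
  rw [sum_prodProb_mul_exp_log_div hQ0]
  refine (mul_le_mul_of_nonneg_left hmoment (Real.exp_pos _).le).trans_eq ?_
  rw [← Real.exp_add]
  congr 1
  ring

theorem card_mul_le_exp_of_disjoint {ι : Type*} {G : Finset ι} {V : ι → Fin n → Z → ℝ}
    {Q : Fin n → Z → ℝ} (hV : ∀ i ∈ G, ∀ t, V i t ∈ stdSimplex ℝ Z) {c : ℝ} (hc : 0 < c)
    (hcQ : ∀ t z, c ≤ Q t z) (hQ : ∀ t, ∑ z, Q t z ≤ 1) {s γ : ℝ} (hs : 0 ≤ s)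
    (hsc : s * Real.log c⁻¹ ≤ 1) (hsγ : s * (Fintype.card Z * (4 + Real.log c⁻¹ ^ 2)) ≤ γ / 2)
    {D : ι → Set (Fin n → Z)} (hD : (G : Set ι).PairwiseDisjoint D) {κ ε : ℝ}
    (hκ : ∀ i ∈ G, ∑ t, kl (V i t) (Q t) ≤ κ) (hε : ∀ i ∈ G, ε ≤ mass (prodProb (V i)) (D i)) :
    #G * (ε - Real.exp (-(n * (s * (γ / 2))))) ≤ Real.exp (κ + n * γ) := by
  have hQ0 : ∀ t z, 0 ≤ Q t z := fun t z => hc.le.trans (hcQ t z)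
  have hmass : ∀ i ∈ G, ε - Real.exp (-(n * (s * (γ / 2)))) ≤
      Real.exp (κ + n * γ) * mass (prodProb Q) (D i) := by
    intro i hi
    have h := mass_prodProb_le (hV i hi) hc hcQ hQ hs hsc (κ + n * γ) (D i)
    have hexp : s * (∑ t, kl (V i t) (Q t) - (κ + n * γ)) +
        n * (s ^ 2 * (Fintype.card Z * (4 + Real.log c⁻¹ ^ 2))) ≤ -(n * (s * (γ / 2))) := by
      have hdiv := mul_le_mul_of_nonneg_left (hκ i hi) hs
      have hvar := mul_le_mul_of_nonneg_left hsγ (mul_nonneg n.cast_nonneg hs : 0 ≤ (n : ℝ) * s)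
      nlinarith
    linarith [hε i hi, Real.exp_le_exp.2 hexp]
  have htotal : ∑ i ∈ G, mass (prodProb Q) (D i) ≤ 1 := by
    refine (sum_mass_le (prodProb_nonneg hQ0) hD).trans ?_
    rw [sum_prodProb]
    exact prod_le_one (fun t _ => sum_nonneg fun z _ => hQ0 t z) fun t _ => hQ t
  have hsum := sum_le_sum hmass
  rw [sum_const, nsmul_eq_mul, ← mul_sum] at hsum
  exact hsum.trans (mul_le_of_le_one_right (Real.exp_pos _).le htotal)

end StrongConverse

/-! ### Types and time sharing -/

section Empirical

open Classical in
/-- The empirical distribution, or type, of a sequence. It vanishes identically for the empty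
sequence. -/
noncomputable def emp {A : Type*} {n : ℕ} (w : Fin n → A) (a : A) : ℝ :=
  #{t | w t = a} / (n : ℝ)

variable {A B U X Y : Type*} {n : ℕ}

open Classical in
theorem emp_eq_sum (w : Fin n → A) (a : A) :
    emp w a = (∑ t, if w t = a then (1 : ℝ) else 0) / n := by
  simp [emp]

theorem emp_nonneg (w : Fin n → A) (a : A) : 0 ≤ emp w a := by
  unfold emp
  positivity

theorem sum_emp_mul [Fintype A] (w : Fin n → A) (f : A → ℝ) :
    ∑ a, emp w a * f a = (∑ t, f (w t)) / n := by
  classical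
  simp_rw [emp_eq_sum, div_mul_eq_mul_div, sum_mul, ← sum_div]
  rw [sum_comm]
  simp

theorem sum_emp [Fintype A] (w : Fin n → A) : ∑ a, emp w a = (n : ℝ) / n := by
  simpa using sum_emp_mul w fun _ => 1

theorem emp_mem_stdSimplex [Fintype A] (hn : n ≠ 0) (w : Fin n → A) :
    emp w ∈ stdSimplex ℝ A :=
  ⟨emp_nonneg w, by rw [sum_emp, div_self (Nat.cast_ne_zero.2 hn)]⟩

theorem emp_comp {f : A → B} (hf : Function.Injective f) (w : Fin n → A) (a : A) :
    emp (fun t => f (w t)) (f a) = emp w a := by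
  classical
  simp [emp_eq_sum, hf.eq_iff]

theorem emp_prodMk_le (u : Fin n → U) (x : Fin n → X) (a : U) (b : X) :
    emp (fun t => (u t, x t)) (a, b) ≤ emp u a := by
  classical
  unfold emp
  gcongr with t
  exact fun h => (Prod.mk.inj h).1

open Classical in
theorem card_image_emp_le [Fintype A] (H : Finset (Fin n → A)) :
    #(H.image emp) ≤ (n + 1) ^ Fintype.card A := by
  have hsub : H.image emp ⊆
      univ.image fun (c : A → Fin (n + 1)) (a : A) => ((c a : ℕ) : ℝ) / n := by
    intro p hp
    obtain ⟨w, -, rfl⟩ := mem_image.1 hp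
    exact mem_image.2 ⟨fun a => ⟨#{t | w t = a},
      Nat.lt_succ_of_le ((card_le_univ _).trans_eq (Fintype.card_fin n))⟩, mem_univ _, rfl⟩
  refine (card_le_card hsub).trans (card_image_le.trans_eq ?_)
  simp

open Classical in
theorem exists_card_le_mul_card_emp_eq [Fintype A] {ι : Type*} (w : ι → Fin n → A)
    {H : Finset ι} (hH : H.Nonempty) :
    ∃ i₀ ∈ H, (#H : ℝ) ≤ (n + 1 : ℝ) ^ Fintype.card A * #{i ∈ H | emp (w i) = emp (w i₀)} := by
  set I := H.image fun i => emp (w i)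
  have hIpos : (0 : ℝ) < #I := by exact_mod_cast card_pos.2 (hH.image _)
  have hIle : (#I : ℝ) ≤ (n + 1 : ℝ) ^ Fintype.card A := by
    have := card_image_emp_le (H.image w)
    rw [image_image] at this
    exact_mod_cast this
  obtain ⟨T, hT, hcard⟩ := exists_le_card_fiber_of_nsmul_le_card_of_maps_to
    (s := H) (t := I) (f := fun i => emp (w i)) (b := (#H : ℝ) / #I)
    (fun i hi => mem_image_of_mem _ hi) (hH.image _)
    (by rw [nsmul_eq_mul, mul_div_cancel₀ _ hIpos.ne'])
  obtain ⟨i₀, hi₀, rfl⟩ := mem_image.1 hT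
  refine ⟨i₀, hi₀, ?_⟩
  rw [div_le_iff₀' hIpos] at hcard
  exact hcard.trans (mul_le_mul_of_nonneg_right hIle (Nat.cast_nonneg _))

/-- The mean square of the conditional type of `x` given `u`, at most `1` and increasing under
refinement of `u`. It is the potential function for the choice of the time-sharing sequence. -/
noncomputable def energy (x : Fin n → X) (u : Fin n → U) : ℝ :=
  (∑ t, emp (fun s => (u s, x s)) (u t, x t) / emp u (u t)) / n

theorem energy_nonneg (x : Fin n → X) (u : Fin n → U) : 0 ≤ energy x u :=
  div_nonneg (sum_nonneg fun _ _ => div_nonneg (emp_nonneg _ _) (emp_nonneg _ _)) n.cast_nonneg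

theorem energy_le_one (x : Fin n → X) (u : Fin n → U) : energy x u ≤ 1 := by
  refine div_le_one_of_le₀ ?_ n.cast_nonneg
  refine (sum_le_sum (g := fun _ => (1 : ℝ)) fun t _ => ?_).trans (by simp)
  exact div_le_one_of_le₀ (emp_prodMk_le _ _ _ _) (emp_nonneg _ _)

theorem energy_comp {f : A → B} (hf : Function.Injective f) (x : Fin n → X) (u : Fin n → A) :
    energy x (fun t => f (u t)) = energy x u := by
  have hpair : ∀ t, emp (fun s => (f (u s), x s)) (f (u t), x t) =
      emp (fun s => (u s, x s)) (u t, x t) := fun t =>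
    emp_comp (hf.prodMap Function.injective_id) (fun s => (u s, x s)) (u t, x t)
  simp only [energy, hpair, emp_comp hf]

theorem energy_eq_sum [Fintype U] [Fintype X] (x : Fin n → X) (u : Fin n → U) :
    energy x u = ∑ a, ∑ b, emp (fun s => (u s, x s)) (a, b) ^ 2 / emp u a := by
  rw [energy, ← sum_emp_mul (fun t => (u t, x t))
    (fun p => emp (fun s => (u s, x s)) (p.1, p.2) / emp u p.1), Fintype.sum_prod_type]
  refine sum_congr rfl fun a _ => sum_congr rfl fun b _ => ?_
  ring

end Empirical

section Markov

variable {U X Y : Type*} {P : U × X × Y → ℝ}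

/-- The `(U, X)`-marginal of a weight on `U × X × Y`. -/
def marginalUX [Fintype Y] (P : U × X × Y → ℝ) (u : U) (x : X) : ℝ := ∑ y, P (u, x, y)

/-- The `(U, Y)`-marginal of a weight on `U × X × Y`. -/
def marginalUY [Fintype X] (P : U × X × Y → ℝ) (u : U) (y : Y) : ℝ := ∑ x, P (u, x, y)

/-- The `U`-marginal of a weight on `U × X × Y`. -/
def marginalU [Fintype X] [Fintype Y] (P : U × X × Y → ℝ) (u : U) : ℝ := ∑ x, ∑ y, P (u, x, y)

/-- The weight `P(u, x) P(u, y) / P(u)`, which has the same `(U, X)`- and `(U, Y)`-marginals as `P`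
and makes `X - U - Y` a Markov chain. -/
noncomputable def markovProd [Fintype X] [Fintype Y] (P : U × X × Y → ℝ) (p : U × X × Y) : ℝ :=
  marginalUX P p.1 p.2.1 * marginalUY P p.1 p.2.2 / marginalU P p.1

theorem marginalUX_nonneg [Fintype Y] (hP : ∀ p, 0 ≤ P p) (u : U) (x : X) :
    0 ≤ marginalUX P u x := sum_nonneg fun _ _ => hP _

theorem marginalUY_nonneg [Fintype X] (hP : ∀ p, 0 ≤ P p) (u : U) (y : Y) :
    0 ≤ marginalUY P u y := sum_nonneg fun _ _ => hP _

theorem eq_zero_of_marginalUY_eq_zero [Fintype X] (hP : ∀ p, 0 ≤ P p) {u : U} {y : Y}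
    (h : marginalUY P u y = 0) (x : X) : P (u, x, y) = 0 :=
  (sum_eq_zero_iff_of_nonneg fun _ _ => hP _).1 h x (mem_univ x)

variable [Fintype X] [Fintype Y]

theorem sum_marginalUY (P : U × X × Y → ℝ) (u : U) : ∑ y, marginalUY P u y = marginalU P u :=
  sum_comm

theorem marginalU_nonneg (hP : ∀ p, 0 ≤ P p) (u : U) : 0 ≤ marginalU P u :=
  sum_nonneg fun x _ => marginalUX_nonneg hP u x

theorem marginalUX_eq_zero (hP : ∀ p, 0 ≤ P p) {u : U} (h : marginalU P u = 0) (x : X) :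
    marginalUX P u x = 0 :=
  (sum_eq_zero_iff_of_nonneg fun x _ => marginalUX_nonneg hP u x).1 h x (mem_univ x)

theorem marginalUY_eq_zero (hP : ∀ p, 0 ≤ P p) {u : U} (h : marginalU P u = 0) (y : Y) :
    marginalUY P u y = 0 := by
  rw [← sum_marginalUY] at h
  exact (sum_eq_zero_iff_of_nonneg fun y _ => marginalUY_nonneg hP u y).1 h y (mem_univ y)

theorem markovProd_nonneg (hP : ∀ p, 0 ≤ P p) (p : U × X × Y) : 0 ≤ markovProd P p :=
  div_nonneg (mul_nonneg (marginalUX_nonneg hP _ _) (marginalUY_nonneg hP _ _))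
    (marginalU_nonneg hP _)

theorem marginalUX_markovProd (hP : ∀ p, 0 ≤ P p) (u : U) (x : X) :
    marginalUX (markovProd P) u x = marginalUX P u x := by
  rw [marginalUX]
  simp only [markovProd]
  rw [← sum_div, ← mul_sum, sum_marginalUY]
  rcases eq_or_ne (marginalU P u) 0 with h | h
  · rw [h, div_zero, marginalUX_eq_zero hP h]
  · rw [mul_div_cancel_right₀ _ h]

theorem marginalUY_markovProd (hP : ∀ p, 0 ≤ P p) (u : U) (y : Y) :
    marginalUY (markovProd P) u y = marginalUY P u y := by
  rw [marginalUY]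
  simp only [markovProd]
  rw [← sum_div, ← sum_mul]
  change marginalU P u * marginalUY P u y / marginalU P u = _
  rcases eq_or_ne (marginalU P u) 0 with h | h
  · rw [h, div_zero, marginalUY_eq_zero hP h]
  · rw [mul_div_cancel_left₀ _ h]

theorem marginalU_markovProd (hP : ∀ p, 0 ≤ P p) (u : U) :
    marginalU (markovProd P) u = marginalU P u :=
  sum_congr rfl fun x _ => marginalUX_markovProd hP u x

theorem markovProd_mem_stdSimplex [Fintype U] (hP : P ∈ stdSimplex ℝ (U × X × Y)) :
    markovProd P ∈ stdSimplex ℝ (U × X × Y) := by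
  refine ⟨markovProd_nonneg hP.1, ?_⟩
  rw [← hP.2]
  simp only [Fintype.sum_prod_type]
  exact sum_congr rfl fun u _ => marginalU_markovProd hP.1 u

theorem isMarkov_markovProd (hP : ∀ p, 0 ≤ P p) : IsMarkov (markovProd P) := by
  intro u x y
  change markovProd P (u, x, y) * marginalU (markovProd P) u =
    marginalUX (markovProd P) u x * marginalUY (markovProd P) u y
  rw [marginalU_markovProd hP, marginalUX_markovProd hP, marginalUY_markovProd hP]
  simp only [markovProd]
  rcases eq_or_ne (marginalU P u) 0 with h | h
  · rw [h, mul_zero, marginalUX_eq_zero hP h, zero_mul]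
  · rw [div_mul_cancel₀ _ h]

/-- Pythagoras: `P(x | u)` is the orthogonal projection of `P(x | u, y)` onto the functions that do
not depend on `y`, for the inner product weighted by `P(u, y)`. -/
theorem sum_sq_sub_markovProd_div [Fintype U] (hP : ∀ p, 0 ≤ P p) :
    ∑ u, ∑ x, ∑ y, (P (u, x, y) - markovProd P (u, x, y)) ^ 2 / marginalUY P u y =
      ∑ u, ∑ x, ∑ y, P (u, x, y) ^ 2 / marginalUY P u y -
        ∑ u, ∑ x, marginalUX P u x ^ 2 / marginalU P u := by
  have hexpand : ∀ u x y, (P (u, x, y) - markovProd P (u, x, y)) ^ 2 / marginalUY P u y =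
      P (u, x, y) ^ 2 / marginalUY P u y -
        2 * (marginalUX P u x / marginalU P u) * P (u, x, y) +
        (marginalUX P u x / marginalU P u) ^ 2 * marginalUY P u y := by
    intro u x y
    simp only [markovProd]
    rcases eq_or_ne (marginalUY P u y) 0 with h | h
    · simp [h, eq_zero_of_marginalUY_eq_zero hP h]
    · field_simp
      ring
  rw [← sum_sub_distrib]
  refine sum_congr rfl fun u _ => ?_
  rw [← sum_sub_distrib]
  refine sum_congr rfl fun x _ => ?_
  simp_rw [hexpand]
  rw [sum_add_distrib, sum_sub_distrib, ← mul_sum, ← mul_sum, sum_marginalUY]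
  change _ - _ * marginalUX P u x + _ = _
  rcases eq_or_ne (marginalU P u) 0 with h | h
  · simp [h]
  · field_simp
    ring

theorem sq_sum_abs_sub_markovProd_le [Fintype U] (hP : ∀ p, 0 ≤ P p) (hP1 : ∑ p, P p ≤ 1) :
    (∑ p, |P p - markovProd P p|) ^ 2 ≤
      Fintype.card X * (∑ u, ∑ x, ∑ y, P (u, x, y) ^ 2 / marginalUY P u y -
        ∑ u, ∑ x, marginalUX P u x ^ 2 / marginalU P u) := by
  have hcs := sum_sq_le_sum_mul_sum_of_sq_le_mul (univ : Finset (U × X × Y))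
    (r := fun p => |P p - markovProd P p|) (f := fun p => marginalUY P p.1 p.2.2)
    (g := fun p => (P p - markovProd P p) ^ 2 / marginalUY P p.1 p.2.2)
    (fun p _ => marginalUY_nonneg hP _ _)
    (fun p _ => div_nonneg (sq_nonneg _) (marginalUY_nonneg hP _ _)) (fun p _ => by
      rw [sq_abs]
      rcases eq_or_ne (marginalUY P p.1 p.2.2) 0 with h | h
      · simp [h, eq_zero_of_marginalUY_eq_zero hP h p.2.1, markovProd]
      · exact (mul_div_cancel₀ _ h).ge)
  have hmass : ∑ p : U × X × Y, marginalUY P p.1 p.2.2 ≤ Fintype.card X := by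
    rw [Fintype.sum_prod_type] at hP1 ⊢
    simp only [Fintype.sum_prod_type, sum_marginalUY, sum_const, card_univ, nsmul_eq_mul,
      ← mul_sum] at hP1 ⊢
    exact mul_le_of_le_one_right (Nat.cast_nonneg _) hP1
  refine hcs.trans ?_
  rw [← sum_sq_sub_markovProd_div hP]
  simp only [Fintype.sum_prod_type (f := fun p => (P p - markovProd P p) ^ 2 / _)]
  simp only [Fintype.sum_prod_type] at hmass ⊢
  exact mul_le_mul_of_nonneg_right hmass (sum_nonneg fun u _ => sum_nonneg fun x _ =>
    sum_nonneg fun y _ => div_nonneg (sq_nonneg _) (marginalUY_nonneg hP _ _))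

end Markov

section TimeSharing

variable {n : ℕ} {U X Y : Type*}

theorem marginalUX_emp [Fintype Y] (u : Fin n → U) (x : Fin n → X) (y : Fin n → Y) (a : U)
    (b : X) :
    marginalUX (emp fun t => (u t, x t, y t)) a b = emp (fun t => (u t, x t)) (a, b) := by
  classical
  simp only [marginalUX, emp_eq_sum, ← sum_div, Prod.mk.injEq]
  rw [sum_comm]
  simp only [ite_and, sum_ite_irrel, sum_ite_eq, mem_univ, if_true, sum_const_zero]

theorem marginalUY_emp [Fintype X] (u : Fin n → U) (x : Fin n → X) (y : Fin n → Y) (a : U)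
    (c : Y) :
    marginalUY (emp fun t => (u t, x t, y t)) a c = emp (fun t => (u t, y t)) (a, c) := by
  classical
  simp only [marginalUY, emp_eq_sum, ← sum_div, Prod.mk.injEq]
  rw [sum_comm]
  simp only [ite_and, sum_ite_irrel, sum_ite_eq, mem_univ, if_true, sum_const_zero]

variable [Fintype X] [Fintype Y]

theorem marginalU_emp (u : Fin n → U) (x : Fin n → X) (y : Fin n → Y) (a : U) :
    marginalU (emp fun t => (u t, x t, y t)) a = emp u a := by
  classical
  change ∑ b, marginalUX (emp fun t => (u t, x t, y t)) a b = _
  simp only [marginalUX_emp, emp_eq_sum, ← sum_div, Prod.mk.injEq]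
  rw [sum_comm]
  simp only [ite_and, sum_ite_irrel, sum_ite_eq, mem_univ, if_true, sum_const_zero]

theorem sq_sum_abs_emp_sub_markovProd_le [Fintype U] (u : Fin n → U) (x : Fin n → X)
    (y : Fin n → Y) :
    (∑ p, |emp (fun t => (u t, x t, y t)) p - markovProd (emp fun t => (u t, x t, y t)) p|) ^ 2 ≤
      Fintype.card X * (energy x (fun t => (u t, y t)) - energy x u) := by
  refine (sq_sum_abs_sub_markovProd_le (emp_nonneg _)
    ((sum_emp _).trans_le (div_self_le_one _))).trans_eq ?_
  have hswap : ∀ a b c, emp (fun t => (u t, x t, y t)) (a, b, c) =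
      emp (fun t => ((u t, y t), x t)) ((a, c), b) := fun a b c =>
    (emp_comp (f := fun p : U × X × Y => ((p.1, p.2.2), p.2.1))
      (by rintro ⟨_, _, _⟩ ⟨_, _, _⟩ h; simp_all) (fun t => (u t, x t, y t)) (a, b, c)).symm
  simp only [marginalUX_emp, marginalUY_emp, marginalU_emp, energy_eq_sum, Fintype.sum_prod_type,
    hswap]
  congr 2
  exact sum_congr rfl fun a _ => sum_comm

variable {ι κ : Type*}

theorem exists_refinement_lt_sum_energy {X : Type*} (x : ι → Fin n → X) (y : κ → Fin n → Y)
    {A : Finset ι} {B : Finset κ} {m : ℕ} (u : Fin n → Fin m) {r : ℝ}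
    (h : #A * #B * r <
      ∑ i ∈ A, ∑ j ∈ B, (energy (x i) (fun t => (u t, y j t)) - energy (x i) u)) :
    ∃ v : Fin n → Fin (m * Fintype.card Y),
      ∑ i ∈ A, energy (x i) u + #A * r < ∑ i ∈ A, energy (x i) v := by
  rw [sum_comm] at h
  obtain ⟨j, -, hj⟩ : ∃ j ∈ B, #A * r <
      ∑ i ∈ A, (energy (x i) (fun t => (u t, y j t)) - energy (x i) u) := by
    refine exists_lt_of_sum_lt (lt_of_eq_of_lt ?_ h)
    rw [sum_const, nsmul_eq_mul]
    ring
  refine ⟨fun t => finProdFinEquiv (u t, Fintype.equivFin Y (y j t)), ?_⟩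
  have hrelabel : ∀ i,
      energy (x i) (fun t => finProdFinEquiv (u t, Fintype.equivFin Y (y j t))) =
        energy (x i) (fun t => (u t, y j t)) := fun i =>
    energy_comp (f := fun p : Fin m × Y => finProdFinEquiv (p.1, Fintype.equivFin Y p.2))
      (fun p q h => by simpa [Prod.ext_iff] using h) (x i) (fun t => (u t, y j t))
  simp_rw [hrelabel]
  rw [sum_sub_distrib] at hj
  linarith

/-- As long as refining `u` by an average `y`-codeword raises the average energy by more than `1/K`,
refine it; the energy being at most `1`, this happens at most `K` times. -/
theorem exists_timeSharing_sum_energy_sub_le [Nonempty Y] {X : Type*} (x : ι → Fin n → X)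
    (y : κ → Fin n → Y) (A : Finset ι) (B : Finset κ) {K : ℕ} (hK : 0 < K) :
    ∃ m ≤ Fintype.card Y ^ K, ∃ u : Fin n → Fin m,
      ∑ i ∈ A, ∑ j ∈ B, (energy (x i) (fun t => (u t, y j t)) - energy (x i) u) ≤
        #A * #B * (1 / K) := by
  rcases A.eq_empty_or_nonempty with rfl | hA
  · exact ⟨1, Nat.one_le_pow _ _ Fintype.card_pos, fun _ => 0, by simp⟩
  by_contra! hgain
  have hgreedy : ∀ k ≤ K + 1, ∃ m ≤ Fintype.card Y ^ k, ∃ u : Fin n → Fin m,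
      (k : ℝ) / K * #A ≤ ∑ i ∈ A, energy (x i) u := by
    intro k
    induction k with
    | zero =>
      exact fun _ =>
        ⟨1, by simp, fun _ => 0, by simpa using sum_nonneg fun i _ => energy_nonneg _ _⟩
    | succ k ih =>
      intro hk
      obtain ⟨m, hm, u, hu⟩ := ih (by lia)
      obtain ⟨v, hv⟩ := exists_refinement_lt_sum_energy x y u
        (hgain m (hm.trans (Nat.pow_le_pow_right Fintype.card_pos (by lia))) u)
      refine ⟨m * Fintype.card Y, Nat.mul_le_mul_right _ hm, v, ?_⟩
      rw [Nat.cast_succ, add_div, add_mul]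
      linarith
  obtain ⟨m, -, u, hu⟩ := hgreedy (K + 1) le_rfl
  have hle : ∑ i ∈ A, energy (x i) u ≤ #A :=
    (sum_le_sum fun i _ => energy_le_one (x i) u).trans (by simp)
  have hlt : (1 : ℝ) < ((K + 1 : ℕ) : ℝ) / K := by
    rw [one_lt_div (by positivity)]
    exact_mod_cast K.lt_succ_self
  exact (hu.trans hle).not_gt (lt_mul_of_one_lt_left (by exact_mod_cast hA.card_pos) hlt)

theorem card_le_two_mul_card_filter_le {H : Finset ι} {g : ι → ℝ} {η : ℝ} (hη : 0 < η)
    (hg : ∑ i ∈ H, g i ^ 2 ≤ #H / 2 * η ^ 2) : (#H : ℝ) ≤ 2 * #{i ∈ H | g i ≤ η} := by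
  have hmarkov : (#{i ∈ H | ¬ g i ≤ η} : ℝ) * η ^ 2 ≤ ∑ i ∈ H, g i ^ 2 := by
    rw [← nsmul_eq_mul]
    refine (card_nsmul_le_sum _ (fun i => g i ^ 2) _ fun i hi => ?_).trans
      (sum_le_sum_of_subset_of_nonneg (filter_subset _ _) fun i _ _ => sq_nonneg _)
    exact pow_le_pow_left₀ hη.le (not_le.1 (mem_filter.1 hi).2).le 2
  have hhalf := le_of_mul_le_mul_right (hmarkov.trans hg) (pow_pos hη 2)
  have hsplit : (#{i ∈ H | g i ≤ η} : ℝ) + #{i ∈ H | ¬ g i ≤ η} = #H := by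
    exact_mod_cast card_filter_add_card_filter_not (s := H) fun i => g i ≤ η
  linarith

theorem exists_common_type [Nonempty X] [Nonempty Y] (x : ι → Fin n → X) (y : κ → Fin n → Y)
    {A : Finset ι} {B : Finset κ} (hA : A.Nonempty) (hB : B.Nonempty) {η : ℝ} (hη : 0 < η)
    {K : ℕ} (hK : 2 * Fintype.card X ≤ K * η ^ 2) :
    ∃ (m : ℕ) (u : Fin n → Fin m) (T : Fin m × X × Y → ℝ) (G : Finset (ι × κ)),
      G ⊆ A ×ˢ B ∧ G.Nonempty ∧ (∀ p ∈ G, emp (fun t => (u t, x p.1 t, y p.2 t)) = T) ∧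
      ∑ p, |T p - markovProd T p| ≤ η ∧
      (#A * #B : ℝ) ≤
        2 * (n + 1 : ℝ) ^ (Fintype.card Y ^ K * (Fintype.card X * Fintype.card Y)) * #G := by
  classical
  have hX : (0 : ℝ) < Fintype.card X := by exact_mod_cast Fintype.card_pos
  have hK0 : (0 : ℝ) < K := pos_of_mul_pos_left ((mul_pos two_pos hX).trans_le hK) (sq_nonneg η)
  obtain ⟨m, hm, u, hu⟩ := exists_timeSharing_sum_energy_sub_le x y A B (Nat.cast_pos.1 hK0)
  set w : ι × κ → Fin n → Fin m × X × Y := fun p t => (u t, x p.1 t, y p.2 t)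
  set g : ι × κ → ℝ := fun p => ∑ q, |emp (w p) q - markovProd (emp (w p)) q|
  have hAB : (#(A ×ˢ B) : ℝ) = #A * #B := by rw [card_product, Nat.cast_mul]
  have hgsum : ∑ p ∈ A ×ˢ B, g p ^ 2 ≤ #(A ×ˢ B) / 2 * η ^ 2 := by
    refine (sum_le_sum fun p _ => sq_sum_abs_emp_sub_markovProd_le u (x p.1) (y p.2)).trans ?_
    rw [← mul_sum, sum_product, hAB]
    refine (mul_le_mul_of_nonneg_left hu hX.le).trans ?_
    rw [mul_one_div, ← mul_div_assoc, div_le_iff₀ hK0]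
    nlinarith [mul_le_mul_of_nonneg_left hK (by positivity : (0 : ℝ) ≤ #A * #B)]
  set H := {p ∈ A ×ˢ B | g p ≤ η}
  have hHcard : (#A * #B : ℝ) ≤ 2 * #H := hAB ▸ card_le_two_mul_card_filter_le hη hgsum
  have hABpos : (0 : ℝ) < #A * #B := by
    exact_mod_cast Nat.mul_pos hA.card_pos hB.card_pos
  have hHne : H.Nonempty := card_pos.1 (Nat.cast_pos.1 (by linarith : (0 : ℝ) < #H))
  obtain ⟨p₀, hp₀, hcard⟩ := exists_card_le_mul_card_emp_eq w hHne
  have hpow : (n + 1 : ℝ) ^ Fintype.card (Fin m × X × Y) ≤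
      (n + 1 : ℝ) ^ (Fintype.card Y ^ K * (Fintype.card X * Fintype.card Y)) := by
    refine pow_le_pow_right₀ (by linarith [n.cast_nonneg (α := ℝ)]) ?_
    simp only [Fintype.card_prod, Fintype.card_fin]
    exact Nat.mul_le_mul_right _ hm
  refine ⟨m, u, emp (w p₀), {p ∈ H | emp (w p) = emp (w p₀)},
    (filter_subset _ _).trans (filter_subset _ _), ⟨p₀, mem_filter.2 ⟨hp₀, rfl⟩⟩,
    fun p hp => (mem_filter.1 hp).2, (mem_filter.1 hp₀).2, ?_⟩
  have := hcard.trans (mul_le_mul_of_nonneg_right hpow (Nat.cast_nonneg _))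
  linarith

end TimeSharing

/-! ### The test channel and its output kernel -/

section SmoothedOutput

variable {A C Z : Type*} [Fintype A] [Fintype Z] {p : A → C → ℝ} {V : A → C → Z → ℝ} {τ : ℝ}

/-- The conditional distribution of the output of `V` given the component `c` of its input `(a, c)`
with law `p`, mixed with a fraction `τ` of the uniform distribution to bound it away from zero. -/
noncomputable def smoothedOutput (p : A → C → ℝ) (V : A → C → Z → ℝ) (τ : ℝ) (c : C) (z : Z) : ℝ :=
  (1 - τ) * ((∑ a, p a c * V a c z) / ∑ a, p a c) + τ / Fintype.card Z

theorem div_card_le_smoothedOutput (hp : ∀ a c, 0 ≤ p a c)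
    (hV : ∀ a c, V a c ∈ stdSimplex ℝ Z) (hτ1 : τ < 1) (c : C) (z : Z) :
    τ / Fintype.card Z ≤ smoothedOutput p V τ c z :=
  le_add_of_nonneg_left <| mul_nonneg (sub_pos.2 hτ1).le <| div_nonneg
    (sum_nonneg fun a _ => mul_nonneg (hp a c) ((hV a c).1 z)) (sum_nonneg fun a _ => hp a c)

theorem sum_smoothedOutput_le_one [Nonempty Z] (hV : ∀ a c, V a c ∈ stdSimplex ℝ Z)
    (hτ1 : τ < 1) (c : C) : ∑ z, smoothedOutput p V τ c z ≤ 1 := by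
  have houtput : ∑ z, ∑ a, p a c * V a c z = ∑ a, p a c := by
    rw [sum_comm]
    exact sum_congr rfl fun a _ => by rw [← mul_sum, (hV a c).2, mul_one]
  simp only [smoothedOutput]
  rw [sum_add_distrib, ← mul_sum, ← sum_div, houtput, sum_const, card_univ, nsmul_eq_mul,
    mul_div_cancel₀ _ (Nat.cast_ne_zero.2 Fintype.card_ne_zero)]
  linarith [mul_le_mul_of_nonneg_left (div_self_le_one (∑ a, p a c)) (sub_pos.2 hτ1).le]

theorem mul_log_div_mixture_le {p v r o b : ℝ} (hp : 0 ≤ p) (hv : 0 ≤ v) (hr : p ≤ r)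
    (ho : p * v ≤ o) (hτ1 : τ < 1) (hb : 0 ≤ b) :
    p * (v * Real.log (v / ((1 - τ) * (o / r) + b))) ≤
      p * v * Real.log (p * v * r / (p * o)) + p * v * Real.log (1 - τ)⁻¹ := by
  rw [← mul_assoc, ← mul_add]
  rcases (mul_nonneg hp hv).eq_or_lt with h0 | h0
  · simp [← h0]
  have hp0 : 0 < p := hp.lt_of_ne' (left_ne_zero_of_mul h0.ne')
  have hv0 : 0 < v := hv.lt_of_ne' (right_ne_zero_of_mul h0.ne')
  have hr0 : 0 < r := hp0.trans_le hr
  have ho0 : 0 < o := h0.trans_le ho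
  have hτ0 : 0 < 1 - τ := sub_pos.2 hτ1
  refine mul_le_mul_of_nonneg_left ?_ h0.le
  rw [← Real.log_mul (by positivity) (by positivity)]
  refine Real.log_le_log (by positivity) ?_
  have hdrop : p * v * r / (p * o) * (1 - τ)⁻¹ = v / ((1 - τ) * (o / r)) := by field_simp
  rw [hdrop]
  exact div_le_div_of_nonneg_left hv (by positivity) (le_add_of_nonneg_right hb)

theorem sum_mul_kl_smoothedOutput_le [Fintype C] (hp : ∀ a c, 0 ≤ p a c)
    (hp1 : ∑ a, ∑ c, p a c = 1) (hV : ∀ a c, V a c ∈ stdSimplex ℝ Z) (hτ : 0 ≤ τ) (hτ1 : τ < 1) :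
    ∑ a, ∑ c, p a c * kl (V a c) (smoothedOutput p V τ c) ≤
      condMutualInfo (fun a z c => p a c * V a c z) + Real.log (1 - τ)⁻¹ := by
  have hrow : ∀ a c, ∑ z, p a c * V a c z = p a c := fun a c => by
    rw [← mul_sum, (hV a c).2, mul_one]
  have hlog : Real.log (1 - τ)⁻¹ = ∑ a, ∑ c, ∑ z, p a c * V a c z * Real.log (1 - τ)⁻¹ := by
    simp only [← sum_mul, hrow, hp1, one_mul]
  unfold condMutualInfo
  rw [hlog, ← sum_add_distrib]
  refine sum_le_sum fun a _ => ?_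
  rw [sum_comm, ← sum_add_distrib]
  refine sum_le_sum fun c _ => ?_
  rw [kl, mul_sum, ← sum_add_distrib]
  refine sum_le_sum fun z _ => ?_
  simp only [hrow]
  exact mul_log_div_mixture_le (hp a c) ((hV a c).1 z)
    (single_le_sum (fun a _ => hp a c) (mem_univ a))
    (single_le_sum (f := fun a => p a c * V a c z)
      (fun a _ => mul_nonneg (hp a c) ((hV a c).1 z)) (mem_univ a)) hτ1 (by positivity)

end SmoothedOutput

section Stability

variable {Ω Z : Type*} [Fintype Ω] [Fintype Z] {P T : Ω → ℝ} {η : ℝ}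

theorem sum_mul_le_add_mul (hTP : ∑ ω, |T ω - P ω| ≤ η) {f : Ω → ℝ} {L : ℝ} (hL : 0 ≤ L)
    (hf : ∀ ω, 0 ≤ f ω) (hfL : ∀ ω, f ω ≤ L) :
    ∑ ω, T ω * f ω ≤ ∑ ω, P ω * f ω + η * L := by
  have hterm : ∀ ω, T ω * f ω ≤ P ω * f ω + |T ω - P ω| * L := fun ω => by
    have hdiff := mul_le_mul (le_abs_self (T ω - P ω)) (hfL ω) (hf ω) (abs_nonneg _)
    linarith
  refine (sum_le_sum fun ω _ => hterm ω).trans ?_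
  rw [sum_add_distrib, ← sum_mul]
  exact add_le_add_right (mul_le_mul_of_nonneg_right hTP hL) _

open Classical in
theorem sum_mul_kl_le_add_mul_log_inv (hP : ∀ ω, 0 ≤ P ω) (hTP : ∑ ω, |T ω - P ω| ≤ η)
    {V V' Q : Ω → Z → ℝ} (hV : ∀ ω, V ω ∈ stdSimplex ℝ Z) (hV' : ∀ ω, V' ω ∈ stdSimplex ℝ Z)
    {μ : ℝ} (hμ : ∑ ω with V' ω ≠ V ω, P ω ≤ μ) {c : ℝ} (hc : 0 < c) (hc1 : c ≤ 1)
    (hcQ : ∀ ω z, c ≤ Q ω z) (hQ : ∀ ω, ∑ z, Q ω z ≤ 1) :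
    ∑ ω, T ω * kl (V' ω) (Q ω) ≤ ∑ ω, P ω * kl (V ω) (Q ω) + (η + μ) * Real.log c⁻¹ := by
  have hL : 0 ≤ Real.log c⁻¹ := Real.log_nonneg ((one_le_inv₀ hc).2 hc1)
  have hkl : ∀ v ∈ stdSimplex ℝ Z, ∀ ω, 0 ≤ kl v (Q ω) := fun v hv ω =>
    kl_nonneg hv.1 (fun z => hc.le.trans (hcQ ω z)) (hv.2 ▸ hQ ω)
      fun z hz => absurd hz (hc.trans_le (hcQ ω z)).ne'
  have hreplace : ∀ ω, P ω * kl (V' ω) (Q ω) ≤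
      P ω * kl (V ω) (Q ω) + (if V' ω ≠ V ω then P ω else 0) * Real.log c⁻¹ := by
    intro ω
    split_ifs with h
    · have hle := mul_le_mul_of_nonneg_left (kl_le_log_inv (hV' ω) hc (hcQ ω)) (hP ω)
      linarith [mul_nonneg (hP ω) (hkl _ (hV ω) ω)]
    · simp [not_not.1 h]
  have hP_sum := sum_le_sum fun ω (_ : ω ∈ univ) => hreplace ω
  rw [sum_add_distrib, ← sum_mul, ← sum_filter] at hP_sum
  have hT_sum := sum_mul_le_add_mul hTP hL (fun ω => hkl _ (hV' ω) ω)
    fun ω => kl_le_log_inv (hV' ω) hc (hcQ ω)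
  linarith [mul_le_mul_of_nonneg_right hμ hL]

end Stability

section TestChannel

variable {U X Y Z : Type*}
  {V W : X → Y → Z → ℝ} {p : X → Y → ℝ} {P T : U × X × Y → ℝ} {η β : ℝ}

/-- The marginal distribution of the input pair. -/
def marginalXY [Fintype U] (P : U × X × Y → ℝ) (x : X) (y : Y) : ℝ := ∑ u, P (u, x, y)

theorem marginalXY_nonneg [Fintype U] (hP : ∀ q, 0 ≤ P q) (x : X) (y : Y) :
    0 ≤ marginalXY P x y :=
  sum_nonneg fun _ _ => hP _

open Classical in
/-- The channel that follows `V` on the input pairs to which `p` gives at least `β`, and `W` on the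
others: it is absolutely continuous with respect to `W` also where `p` vanishes, and only pairs
whose `p`-probability can be compared with that of a nearby distribution contribute to its
divergence from `W`. -/
noncomputable def truncChannel (V W : X → Y → Z → ℝ) (p : X → Y → ℝ) (β : ℝ) : X → Y → Z → ℝ :=
  fun x y => if β ≤ p x y then V x y else W x y

theorem truncChannel_eq_zero (hβ : 0 < β)
    (hac : ∀ x y, 0 < p x y → ∀ z, W x y z = 0 → V x y z = 0) {x : X} {y : Y} {z : Z}
    (hz : W x y z = 0) : truncChannel V W p β x y z = 0 := by
  unfold truncChannel
  split_ifs with h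
  exacts [hac x y (hβ.trans_le h) z hz, hz]

variable [Fintype Z]

theorem isChannel_truncChannel (hV : IsChannel V) (hW : IsChannel W) :
    IsChannel (truncChannel V W p β) := by
  intro x y
  unfold truncChannel
  split_ifs
  exacts [hV x y, hW x y]

theorem mul_kl_nonneg (hV : IsChannel V) (hW : IsChannel W) (hp : ∀ x y, 0 ≤ p x y)
    (hac : ∀ x y, 0 < p x y → ∀ z, W x y z = 0 → V x y z = 0) (x : X) (y : Y) :
    0 ≤ p x y * kl (V x y) (W x y) := by
  rcases (hp x y).eq_or_lt with h0 | h0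
  · simp [← h0]
  · exact mul_nonneg h0.le (kl_nonneg (hV x y).1 (hW x y).1
      ((hW x y).2.trans (hV x y).2.symm).le (hac x y h0))

variable [Fintype X] [Fintype Y]

theorem eq_zero_of_condDivergence_ne_top (h : condDivergence V W p ≠ ⊤) {x : X} {y : Y}
    (hxy : 0 < p x y) (z : Z) (hz : W x y z = 0) : V x y z = 0 := by
  simp only [condDivergence, ENNReal.sum_ne_top] at h
  have hterm := h x (mem_univ x) y (mem_univ y)
  rw [relEntropy] at hterm
  split_ifs at hterm with hac
  · exact hac z hz
  · exact absurd (ENNReal.mul_top (ENNReal.ofReal_pos.2 hxy).ne') hterm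

theorem condDivergence_eq_ofReal (hV : IsChannel V) (hW : IsChannel W) (hp : ∀ x y, 0 ≤ p x y)
    (hac : ∀ x y, 0 < p x y → ∀ z, W x y z = 0 → V x y z = 0) :
    condDivergence V W p = ENNReal.ofReal (∑ x, ∑ y, p x y * kl (V x y) (W x y)) := by
  have hnonneg := mul_kl_nonneg hV hW hp hac
  rw [ENNReal.ofReal_sum_of_nonneg fun x _ => sum_nonneg fun y _ => hnonneg x y]
  refine sum_congr rfl fun x _ => ?_
  rw [ENNReal.ofReal_sum_of_nonneg fun y _ => hnonneg x y]
  refine sum_congr rfl fun y _ => ?_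
  rcases (hp x y).eq_or_lt with h0 | h0
  · simp [← h0]
  · rw [relEntropy, if_pos (hac x y h0), ENNReal.ofReal_mul h0.le, kl]

theorem exists_meetsRateCondition_of_exponent_lt {m : ℕ} {P : Fin m × X × Y → ℝ}
    (hP : P ∈ stdSimplex ℝ (Fin m × X × Y)) (hPM : IsMarkov P) (hW : IsChannel W) {RX RY e : ℝ}
    (he : 0 ≤ e) (hE : maxErrorSpherePackingExponent RX RY W < ENNReal.ofReal e) :
    ∃ V : X → Y → Z → ℝ, IsChannel V ∧ MeetsRateCondition RX RY P V ∧
      (∀ x y, 0 < marginalXY P x y → ∀ z, W x y z = 0 → V x y z = 0) ∧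
      ∑ x, ∑ y, marginalXY P x y * kl (V x y) (W x y) ≤ e := by
  have hlt : (⨅ (V : X → Y → Z → ℝ) (_ : IsChannel V) (_ : MeetsRateCondition RX RY P V),
      condDivergence V W (marginalXY P)) < ENNReal.ofReal e := by
    refine lt_of_le_of_lt ?_ hE
    unfold maxErrorSpherePackingExponent
    exact le_iSup₂_of_le m P (le_iSup₂_of_le hP hPM le_rfl)
  simp only [iInf_lt_iff] at hlt
  obtain ⟨V, hV, hrate, hdiv⟩ := hlt
  have hac : ∀ x y, 0 < marginalXY P x y → ∀ z, W x y z = 0 → V x y z = 0 := fun x y =>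
    eq_zero_of_condDivergence_ne_top (hdiv.trans ENNReal.ofReal_lt_top).ne
  rw [condDivergence_eq_ofReal hV hW (marginalXY_nonneg hP.1) hac] at hdiv
  exact ⟨V, hV, hrate, hac, (ENNReal.ofReal_le_ofReal_iff he).1 hdiv.le⟩

variable [Fintype U]

open Classical in
theorem sum_truncChannel_ne_le (hP : ∀ q, 0 ≤ P q) (hβ : 0 ≤ β) :
    ∑ q with truncChannel V W (marginalXY P) β q.2.1 q.2.2 ≠ V q.2.1 q.2.2, P q ≤
      Fintype.card X * Fintype.card Y * β := by
  have hrare : ∀ q : U × X × Y, truncChannel V W (marginalXY P) β q.2.1 q.2.2 ≠ V q.2.1 q.2.2 →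
      marginalXY P q.2.1 q.2.2 < β := fun q h => by
    by_contra! hle
    exact h (if_pos hle)
  calc ∑ q with truncChannel V W (marginalXY P) β q.2.1 q.2.2 ≠ V q.2.1 q.2.2, P q
      ≤ ∑ q with marginalXY P q.2.1 q.2.2 < β, P q :=
        sum_le_sum_of_subset_of_nonneg (monotone_filter_right _ fun q _ => hrare q)
          fun q _ _ => hP q
    _ = ∑ x, ∑ y, if marginalXY P x y < β then marginalXY P x y else 0 := by
        rw [sum_filter, Fintype.sum_prod_type, sum_comm, Fintype.sum_prod_type]
        refine sum_congr rfl fun x _ => sum_congr rfl fun y _ => ?_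
        split_ifs <;> simp [marginalXY]
    _ ≤ ∑ _x : X, ∑ _y : Y, β := by
        refine sum_le_sum fun x _ => sum_le_sum fun y _ => ?_
        split_ifs with h
        exacts [h.le, hβ]
    _ = Fintype.card X * Fintype.card Y * β := by simp [mul_assoc]

theorem marginalXY_le_add (hTP : ∑ q, |T q - P q| ≤ η) (x : X) (y : Y) :
    marginalXY T x y ≤ marginalXY P x y + η := by
  rw [← sub_le_iff_le_add', marginalXY, marginalXY, ← sum_sub_distrib]
  refine le_trans ?_ hTP
  rw [Fintype.sum_prod_type]
  exact sum_le_sum fun u _ => (le_abs_self _).trans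
    (single_le_sum (f := fun q : X × Y => |T (u, q) - P (u, q)|) (fun _ _ => abs_nonneg _)
      (mem_univ (x, y)))

theorem sum_mul_kl_truncChannel_le (hV : IsChannel V) (hW : IsChannel W) (hP : ∀ q, 0 ≤ P q)
    (hβ : 0 < β) (hη : 0 ≤ η) (hTP : ∑ q, |T q - P q| ≤ η)
    (hac : ∀ x y, 0 < marginalXY P x y → ∀ z, W x y z = 0 → V x y z = 0) :
    ∑ q, T q * kl (truncChannel V W (marginalXY P) β q.2.1 q.2.2) (W q.2.1 q.2.2) ≤
      (1 + η / β) * ∑ x, ∑ y, marginalXY P x y * kl (V x y) (W x y) := by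
  simp only [mul_sum]
  rw [Fintype.sum_prod_type, sum_comm, Fintype.sum_prod_type]
  refine sum_le_sum fun x _ => sum_le_sum fun y _ => ?_
  dsimp only
  rw [← sum_mul, ← mul_assoc]
  change marginalXY T x y * _ ≤ _
  unfold truncChannel
  split_ifs with h
  · refine mul_le_mul_of_nonneg_right ?_ (kl_nonneg (hV x y).1 (hW x y).1
      ((hW x y).2.trans (hV x y).2.symm).le (hac x y (hβ.trans_le h)))
    have hη_le : η ≤ η / β * marginalXY P x y := by
      rw [div_mul_eq_mul_div, le_div_iff₀ hβ]
      exact mul_le_mul_of_nonneg_left h hη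
    linarith [marginalXY_le_add hTP x y]
  · rw [kl_self, mul_zero, mul_assoc]
    exact mul_nonneg (by positivity)
      (mul_kl_nonneg hV hW (marginalXY_nonneg hP) hac x y)

end TestChannel

/-! ### Codes for a channel that meets the rate condition -/

section Rate

/-- Parameters whose joint loss in rate is at most `γ`: the weight `τ` of the uniform part of the
output kernel, the distance `η` between the type of the codewords and its Markovization, the
probability `μ` of the inputs at which the test channel is modified, and the exponent `s` in
Chernoff's bound. -/
structure RateSlack (Z : Type*) [Fintype Z] (γ τ η μ s : ℝ) : Prop where
  pos : 0 < τ
  lt_one : τ < 1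
  rate_loss : Real.log (1 - τ)⁻¹ + (η + μ) * Real.log (τ / Fintype.card Z)⁻¹ ≤ γ
  nonneg : 0 ≤ s
  mul_log_le_one : s * Real.log (τ / Fintype.card Z)⁻¹ ≤ 1
  mul_variance_le : s * (Fintype.card Z * (4 + Real.log (τ / Fintype.card Z)⁻¹ ^ 2)) ≤ γ / 2

variable {Z : Type*} [Fintype Z] [Nonempty Z] {n : ℕ} {γ τ η μ s ε : ℝ}

theorem sum_comp_eq_mul_sum_emp_mul {A : Type*} [Fintype A] (w : Fin n → A) (f : A → ℝ) :
    ∑ t, f (w t) = n * ∑ a, emp w a * f a := by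
  rcases eq_or_ne n 0 with rfl | hn
  · simp
  · rw [sum_emp_mul, mul_div_cancel₀ _ (Nat.cast_ne_zero.2 hn)]

open Classical in
theorem sum_mul_kl_smoothedOutput_le_of_condMutualInfo_le {Ω A C : Type*} [Fintype Ω] [Fintype A]
    [Fintype C] (e : A × C ≃ Ω) (hpar : RateSlack Z γ τ η μ s) {P T : Ω → ℝ}
    (hP : P ∈ stdSimplex ℝ Ω) (hTP : ∑ ω, |T ω - P ω| ≤ η) {V V' : Ω → Z → ℝ}
    (hV : ∀ ω, V ω ∈ stdSimplex ℝ Z) (hV' : ∀ ω, V' ω ∈ stdSimplex ℝ Z)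
    (hμ : ∑ ω with V' ω ≠ V ω, P ω ≤ μ) {R : ℝ}
    (hR : condMutualInfo (fun a z c => P (e (a, c)) * V (e (a, c)) z) ≤ R) :
    ∑ ω, T ω * kl (V' ω)
      (smoothedOutput (fun a c => P (e (a, c))) (fun a c => V (e (a, c))) τ (e.symm ω).2) ≤
      R + γ := by
  have hZ : (1 : ℝ) ≤ Fintype.card Z := Nat.one_le_cast.2 Fintype.card_pos
  have hP1 : ∑ a, ∑ c, P (e (a, c)) = 1 := by
    rw [← hP.2, ← e.sum_comp, Fintype.sum_prod_type]
  have hT := sum_mul_kl_le_add_mul_log_inv hP.1 hTP hV hV' hμ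
    (div_pos hpar.pos (one_pos.trans_le hZ))
    (div_le_one_of_le₀ (hpar.lt_one.le.trans hZ) (zero_le_one.trans hZ))
    (fun ω => div_card_le_smoothedOutput (fun a c => hP.1 (e (a, c))) (fun a c => hV (e (a, c)))
      hpar.lt_one (e.symm ω).2)
    (fun ω => sum_smoothedOutput_le_one (fun a c => hV (e (a, c))) hpar.lt_one (e.symm ω).2)
  have hI := sum_mul_kl_smoothedOutput_le (fun a c => hP.1 (e (a, c))) hP1
    (fun a c => hV (e (a, c))) hpar.pos.le hpar.lt_one
  have hsum : ∑ ω, P ω * kl (V ω)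
      (smoothedOutput (fun a c => P (e (a, c))) (fun a c => V (e (a, c))) τ (e.symm ω).2) =
      ∑ a, ∑ c, P (e (a, c)) * kl (V (e (a, c)))
        (smoothedOutput (fun a c => P (e (a, c))) (fun a c => V (e (a, c))) τ c) := by
    rw [← e.sum_comp, Fintype.sum_prod_type]
    simp only [Equiv.symm_apply_apply]
  linarith [hpar.rate_loss]

open Classical in
theorem card_mul_le_exp_of_condMutualInfo_le {Ω A C ι : Type*} [Fintype Ω] [Fintype A]
    [Fintype C] (e : A × C ≃ Ω) (hpar : RateSlack Z γ τ η μ s) {P T : Ω → ℝ}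
    (hP : P ∈ stdSimplex ℝ Ω) (hTP : ∑ ω, |T ω - P ω| ≤ η) {V V' : Ω → Z → ℝ}
    (hV : ∀ ω, V ω ∈ stdSimplex ℝ Z) (hV' : ∀ ω, V' ω ∈ stdSimplex ℝ Z)
    (hμ : ∑ ω with V' ω ≠ V ω, P ω ≤ μ) {R : ℝ}
    (hR : condMutualInfo (fun a z c => P (e (a, c)) * V (e (a, c)) z) ≤ R)
    {G : Finset ι} {w : ι → Fin n → Ω} (hw : ∀ i ∈ G, emp (w i) = T) {c : Fin n → C}
    (hc : ∀ i ∈ G, ∀ t, (e.symm (w i t)).2 = c t) {D : ι → Set (Fin n → Z)}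
    (hD : (G : Set ι).PairwiseDisjoint D)
    (hε : ∀ i ∈ G, ε ≤ mass (prodProb fun t => V' (w i t)) (D i)) :
    #G * (ε - Real.exp (-(n * (s * (γ / 2))))) ≤ Real.exp (n * (R + 2 * γ)) := by
  have hT := sum_mul_kl_smoothedOutput_le_of_condMutualInfo_le e hpar hP hTP hV hV' hμ hR
  set Q := smoothedOutput (fun a c => P (e (a, c))) (fun a c => V (e (a, c))) τ
  have hκ : ∀ i ∈ G, ∑ t, kl (V' (w i t)) (Q (c t)) ≤ n * (R + γ) := by
    intro i hi
    simp only [← hc i hi]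
    rw [sum_comp_eq_mul_sum_emp_mul (w i) fun ω => kl (V' ω) (Q (e.symm ω).2), hw i hi]
    exact mul_le_mul_of_nonneg_left hT n.cast_nonneg
  have h := card_mul_le_exp_of_disjoint (V := fun i t => V' (w i t)) (Q := fun t => Q (c t))
    (fun i _ t => hV' (w i t))
    (div_pos hpar.pos (Nat.cast_pos.2 Fintype.card_pos))
    (fun t => div_card_le_smoothedOutput (fun a c => hP.1 (e (a, c)))
      (fun a c => hV (e (a, c))) hpar.lt_one (c t))
    (fun t => sum_smoothedOutput_le_one (fun a c => hV (e (a, c))) hpar.lt_one (c t))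
    hpar.nonneg hpar.mul_log_le_one hpar.mul_variance_le hD hκ hε
  rwa [← mul_add, add_assoc, ← two_mul] at h

theorem card_mul_le_card_mul_of_fiber_le {ι κ : Type*} [DecidableEq κ] {G : Finset ι}
    {B : Finset κ} {f : ι → κ} (hf : ∀ i ∈ G, f i ∈ B) {a b : ℝ}
    (h : ∀ j ∈ B, #{i ∈ G | f i = j} * a ≤ b) : #G * a ≤ #B * b := by
  rw [card_eq_sum_card_fiberwise hf, Nat.cast_sum, sum_mul, ← nsmul_eq_mul]
  exact sum_le_card_nsmul _ _ _ h

open Classical in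
theorem card_mul_le_of_meetsRateCondition {U X Y ι κ : Type*} [Fintype U] [Fintype X] [Fintype Y]
    (hpar : RateSlack Z γ τ η μ s) {P T : U × X × Y → ℝ} (hP : P ∈ stdSimplex ℝ (U × X × Y))
    (hTP : ∑ q, |T q - P q| ≤ η) {V V' : X → Y → Z → ℝ} (hV : IsChannel V) (hV' : IsChannel V')
    (hμ : ∑ q with V' q.2.1 q.2.2 ≠ V q.2.1 q.2.2, P q ≤ μ) {RX RY δ : ℝ}
    (hrate : MeetsRateCondition RX RY P V) {A : Finset ι} {B : Finset κ} {G : Finset (ι × κ)}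
    (hG : G ⊆ A ×ˢ B) {u : Fin n → U} {x : ι → Fin n → X} {y : κ → Fin n → Y}
    (hw : ∀ p ∈ G, emp (fun t => (u t, x p.1 t, y p.2 t)) = T) {D : ι → κ → Set (Fin n → Z)}
    (hD : (G : Set (ι × κ)).PairwiseDisjoint fun p => D p.1 p.2)
    (hε : ∀ p ∈ G, ε ≤ mass (prodProb fun t => V' (x p.1 t) (y p.2 t)) (D p.1 p.2)) (hδ : 0 ≤ δ)
    (hA : Real.exp (n * (RX + δ)) ≤ #A) (hB : Real.exp (n * (RY + δ)) ≤ #B) :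
    #G * (ε - Real.exp (-(n * (s * (γ / 2))))) ≤ #A * #B * Real.exp (-(n * (δ - 2 * γ))) := by
  have hsplit : ∀ R, Real.exp (n * (R + 2 * γ)) =
      Real.exp (n * (R + δ)) * Real.exp (-(n * (δ - 2 * γ))) := fun R => by
    rw [← Real.exp_add]
    ring_nf
  have hV₃ : ∀ q : U × X × Y, V q.2.1 q.2.2 ∈ stdSimplex ℝ Z := fun q => hV q.2.1 q.2.2
  have hV₃' : ∀ q : U × X × Y, V' q.2.1 q.2.2 ∈ stdSimplex ℝ Z := fun q => hV' q.2.1 q.2.2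
  let eX : X × (Y × U) ≃ U × X × Y :=
    ⟨fun q => (q.2.2, q.1, q.2.1), fun q => (q.2.1, q.2.2, q.1), fun _ => rfl, fun _ => rfl⟩
  let eY : Y × (X × U) ≃ U × X × Y :=
    ⟨fun q => (q.2.2, q.2.1, q.1), fun q => (q.2.2, q.2.1, q.1), fun _ => rfl, fun _ => rfl⟩
  rcases hrate with hI | hI | hI
  · have hfiber := card_mul_le_card_mul_of_fiber_le (f := Prod.snd)
      (fun p hp => (mem_product.1 (hG hp)).2) fun j _ =>
        card_mul_le_exp_of_condMutualInfo_le (c := fun t => (y j t, u t))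
          eX hpar hP hTP hV₃ hV₃' hμ hI (fun p hp => hw p (mem_filter.1 hp).1)
          (fun p hp t => by rw [← (mem_filter.1 hp).2]; rfl)
          (hD.subset (filter_subset _ G)) fun p hp => hε p (mem_filter.1 hp).1
    refine hfiber.trans ?_
    rw [hsplit, mul_left_comm, ← mul_assoc]
    gcongr
  · have hfiber := card_mul_le_card_mul_of_fiber_le (f := Prod.fst)
      (fun p hp => (mem_product.1 (hG hp)).1) fun i _ =>
        card_mul_le_exp_of_condMutualInfo_le (c := fun t => (x i t, u t))
          eY hpar hP hTP hV₃ hV₃' hμ hI (fun p hp => hw p (mem_filter.1 hp).1)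
          (fun p hp t => by rw [← (mem_filter.1 hp).2]; rfl)
          (hD.subset (filter_subset _ G)) fun p hp => hε p (mem_filter.1 hp).1
    refine hfiber.trans ?_
    rw [hsplit, ← mul_assoc]
    gcongr
  · have hall := card_mul_le_exp_of_condMutualInfo_le (c := u) (Equiv.prodComm _ _)
      hpar hP hTP hV₃ hV₃' hμ hI hw (fun p _ t => rfl) hD hε
    rw [hsplit] at hall
    have hAB : Real.exp (n * (RX + RY + δ)) ≤ #A * #B := by
      refine le_trans ?_ (mul_le_mul hA hB (Real.exp_pos _).le (Nat.cast_nonneg _))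
      rw [← Real.exp_add, Real.exp_le_exp, ← mul_add]
      exact mul_le_mul_of_nonneg_left (by linarith) n.cast_nonneg
    exact hall.trans (by gcongr)

end Rate

/-! ### The maximal error probability -/

section MaximalError

theorem eventually_mul_lt_nhdsGT_zero (b : ℝ) {r : ℝ} (hr : 0 < r) :
    ∀ᶠ c in nhdsWithin (0 : ℝ) (Set.Ioi 0), b * c < r :=
  (((continuous_const_mul b).tendsto' 0 0 (mul_zero b)).eventually_lt_const hr).filter_mono
    nhdsWithin_le_nhds

theorem exists_rateSlack (Z : Type*) [Fintype Z] {γ ρ : ℝ} (hγ : 0 < γ) (hρ : 0 < ρ) (k : ℝ) :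
    ∃ τ β η s : ℝ, 0 < β ∧ 0 < η ∧ η / β ≤ ρ ∧ 0 < s ∧ RateSlack Z γ τ η (k * β) s := by
  set τ := 1 - Real.exp (-(γ / 2)) with hτ
  have hτ0 : 0 < τ := sub_pos.2 (Real.exp_lt_one_iff.2 (by linarith))
  have hτ_log : Real.log (1 - τ)⁻¹ = γ / 2 := by
    rw [hτ, sub_sub_cancel, Real.log_inv, Real.log_exp, neg_neg]
  set L := Real.log (τ / Fintype.card Z)⁻¹
  obtain ⟨β, hβL, hβ⟩ :=
    ((eventually_mul_lt_nhdsGT_zero (L * k) (by linarith : 0 < γ / 4)).and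
      self_mem_nhdsWithin).exists
  obtain ⟨η, ⟨hηL, hηβ⟩, hη⟩ :=
    (((eventually_mul_lt_nhdsGT_zero L (by linarith : 0 < γ / 4)).and
      (eventually_mul_lt_nhdsGT_zero 1 (mul_pos hρ hβ))).and self_mem_nhdsWithin).exists
  obtain ⟨s, ⟨hsL, hsC⟩, hs⟩ :=
    (((eventually_mul_lt_nhdsGT_zero L one_pos).and
      (eventually_mul_lt_nhdsGT_zero (Fintype.card Z * (4 + L ^ 2)) (half_pos hγ))).and
      self_mem_nhdsWithin).exists
  refine ⟨τ, β, η, s, hβ, hη, (div_le_iff₀ hβ).2 (one_mul η ▸ hηβ.le), hs, hτ0,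
    sub_lt_self 1 (Real.exp_pos _), ?_, le_of_lt hs, (mul_comm s L).trans_le hsL.le,
    (mul_comm s _).trans_le hsC.le⟩
  rw [hτ_log]
  linarith

theorem tendsto_add_one_pow_mul_exp_neg (J : ℕ) {b : ℝ} (hb : 0 < b) :
    Tendsto (fun n : ℕ => (n + 1 : ℝ) ^ J * Real.exp (-(n * b))) atTop (nhds 0) := by
  have hlim := (((isLittleO_pow_exp_pos_mul_atTop J hb).tendsto_div_nhds_zero.comp
    (tendsto_natCast_atTop_atTop (R := ℝ))).comp (tendsto_add_atTop_nat 1)).const_mul (Real.exp b)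
  rw [mul_zero] at hlim
  refine hlim.congr fun n => ?_
  simp only [Function.comp_apply]
  push_cast
  rw [div_eq_mul_inv, ← Real.exp_neg, mul_left_comm, ← Real.exp_add]
  ring_nf

variable {X Y Z : Type*} [Fintype X] [Fintype Y] [Fintype Z] {W : X → Y → Z → ℝ}
  {RX RY r δ τ β η s : ℝ}

open Classical in
theorem exists_testChannel {m : ℕ} {T : Fin m × X × Y → ℝ}
    (hT : T ∈ stdSimplex ℝ (Fin m × X × Y)) (hTM : ∑ q, |T q - markovProd T q| ≤ η)
    (hW : IsChannel W) (hβ : 0 < β) (hη : 0 ≤ η) (hr : 0 ≤ r)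
    (hE : maxErrorSpherePackingExponent RX RY W < ENNReal.ofReal r) :
    ∃ V V' : X → Y → Z → ℝ, IsChannel V ∧ IsChannel V' ∧
      MeetsRateCondition RX RY (markovProd T) V ∧
      ∑ q with V' q.2.1 q.2.2 ≠ V q.2.1 q.2.2, markovProd T q ≤
        Fintype.card X * Fintype.card Y * β ∧
      (∀ x y z, W x y z = 0 → V' x y z = 0) ∧
      ∑ q, T q * kl (V' q.2.1 q.2.2) (W q.2.1 q.2.2) ≤ (1 + η / β) * r := by
  have hP := markovProd_mem_stdSimplex hT
  obtain ⟨V, hV, hrate, hac, hdiv⟩ :=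
    exists_meetsRateCondition_of_exponent_lt hP (isMarkov_markovProd hT.1) hW hr hE
  exact ⟨V, truncChannel V W (marginalXY (markovProd T)) β, hV, isChannel_truncChannel hV hW,
    hrate, sum_truncChannel_ne_le hP.1 hβ.le, fun x y z => truncChannel_eq_zero hβ hac,
    (sum_mul_kl_truncChannel_le hV hW hP.1 hβ hη hTM hac).trans
      (mul_le_mul_of_nonneg_left hdiv (by positivity))⟩

theorem le_mass_of_blockProbSet_compl_mul_exp_le_one {U : Type*} [Fintype U] {n : ℕ}
    {V : X → Y → Z → ℝ} (hV : IsChannel V) (hW : IsChannel W)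
    (hac : ∀ x y z, W x y z = 0 → V x y z = 0) {u : Fin n → U} {x : Fin n → X} {y : Fin n → Y}
    {κ : ℝ} (hκ : ∑ q, emp (fun t => (u t, x t, y t)) q * kl (V q.2.1 q.2.2) (W q.2.1 q.2.2) ≤ κ)
    {D : Set (Fin n → Z)} {a ε : ℝ} (ha : 0 < a) (hD : blockProbSet W x y Dᶜ * Real.exp a ≤ 1)
    (hε : n * κ + Real.log 2 ≤ a * (1 - ε)) :
    ε ≤ mass (prodProb fun t => V (x t) (y t)) D := by
  refine le_mass_of_mass_compl_mul_exp_le_one (q := prodProb fun t => W (x t) (y t))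
    (prodProb_mem_stdSimplex fun t => hV _ _) (prodProb_mem_stdSimplex fun t => hW _ _)
    (fun z hz => ?_) ha hD ?_
  · contrapose! hz
    rw [prodProb_ne_zero] at hz ⊢
    exact fun t => mt (hac _ _ _) (hz t)
  · rw [kl_prodProb (fun t => (hV _ _).2) fun t => hac _ _, sum_comp_eq_mul_sum_emp_mul
      (fun t => (u t, x t, y t)) fun q => kl (V q.2.1 q.2.2) (W q.2.1 q.2.2)]
    linarith [mul_le_mul_of_nonneg_left hκ n.cast_nonneg]

variable [Nonempty X] [Nonempty Y] [Nonempty Z]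

theorem sub_exp_le_of_forall_blockProbSet_compl_mul_exp_le_one {ι κ : Type*} {n : ℕ}
    (hpar : RateSlack Z (δ / 4) τ η (Fintype.card X * Fintype.card Y * β) s) (hβ : 0 < β)
    (hη : 0 < η) (hηβ : η / β ≤ δ / 2) {K : ℕ} (hK : 2 * Fintype.card X ≤ K * η ^ 2)
    (hW : IsChannel W) (hr : 0 < r)
    (hE : maxErrorSpherePackingExponent RX RY W < ENNReal.ofReal r) (hδ : 0 < δ) (hn : n ≠ 0)
    (hnδ : Real.log 2 ≤ n * (r * (δ / 4))) {x : ι → Fin n → X} {y : κ → Fin n → Y} {A : Finset ι}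
    {B : Finset κ} (hA : Real.exp (n * (RX + δ)) ≤ #A) (hB : Real.exp (n * (RY + δ)) ≤ #B)
    {D : ι → κ → Set (Fin n → Z)}
    (hD : Pairwise fun p q : ι × κ => Disjoint (D p.1 p.2) (D q.1 q.2))
    (herr : ∀ i ∈ A, ∀ j ∈ B,
      blockProbSet W (x i) (y j) (D i j)ᶜ * Real.exp (n * (r * (1 + δ))) ≤ 1) :
    δ / 4 / (1 + δ) - Real.exp (-(n * (s * (δ / 8)))) ≤
      2 * ((n + 1 : ℝ) ^ (Fintype.card Y ^ K * (Fintype.card X * Fintype.card Y)) *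
        Real.exp (-(n * (δ / 2)))) := by
  have hA0 : A.Nonempty := card_pos.1 (Nat.cast_pos.1 ((Real.exp_pos _).trans_le hA))
  have hB0 : B.Nonempty := card_pos.1 (Nat.cast_pos.1 ((Real.exp_pos _).trans_le hB))
  obtain ⟨m, u, T, G, hGAB, ⟨p, hp⟩, hT, hTM, hcard⟩ := exists_common_type x y hA0 hB0 hη hK
  have hTmem : T ∈ stdSimplex ℝ (Fin m × X × Y) := hT p hp ▸ emp_mem_stdSimplex hn _
  obtain ⟨V, V', hV, hV', hrate, hVV', hac, hdiv⟩ :=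
    exists_testChannel hTmem hTM hW hβ hη.le hr.le hE
  have hdiv' : ∑ q, T q * kl (V' q.2.1 q.2.2) (W q.2.1 q.2.2) ≤ (1 + δ / 2) * r :=
    hdiv.trans (by gcongr)
  have hsuccess : ∀ q ∈ G, δ / 4 / (1 + δ) ≤
      mass (prodProb fun t => V' (x q.1 t) (y q.2 t)) (D q.1 q.2) := fun q hq => by
    obtain ⟨hqA, hqB⟩ := mem_product.1 (hGAB hq)
    refine le_mass_of_blockProbSet_compl_mul_exp_le_one hV' hW hac ((hT q hq).symm ▸ hdiv')
      (by positivity) (herr _ hqA _ hqB) ?_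
    have : n * (r * (1 + δ)) * (1 - δ / 4 / (1 + δ)) = n * (r * (1 + δ - δ / 4)) := by
      field_simp
    linarith
  have hcode := card_mul_le_of_meetsRateCondition hpar (markovProd_mem_stdSimplex hTmem) hTM hV hV'
    hVV' hrate hGAB hT (hD.set_pairwise _) hsuccess hδ.le hA hB
  have hG : (0 : ℝ) < #G := Nat.cast_pos.2 (card_pos.2 ⟨p, hp⟩)
  refine le_of_mul_le_mul_left ?_ hG
  have hbound := hcode.trans (mul_le_mul_of_nonneg_right hcard (Real.exp_pos _).le)
  ring_nf at hbound ⊢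
  exact hbound

theorem eventually_exists_exp_le_blockProbSet_compl (X Y Z : Type*) [Fintype X] [Fintype Y]
    [Fintype Z] [Nonempty X] [Nonempty Y] [Nonempty Z] (RX RY : ℝ) {δ : ℝ} (hδ : 0 < δ) :
    ∀ᶠ n : ℕ in atTop, ∀ W : X → Y → Z → ℝ, IsChannel W → ∀ (M N : ℕ) (C : Code X Y Z n M N)
      (A : Finset (Fin M)) (B : Finset (Fin N)),
      Real.exp (n * (RX + δ)) ≤ #A → Real.exp (n * (RY + δ)) ≤ #B → ∀ e : ℝ, 0 ≤ e →
      maxErrorSpherePackingExponent RX RY W ≤ ENNReal.ofReal e → ∃ i ∈ A, ∃ j ∈ B,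
        Real.exp (-(n * ((e + δ) * (1 + δ)))) ≤
          blockProbSet W (C.cwX i) (C.cwY j) (C.dec i j)ᶜ := by
  obtain ⟨τ, β, η, s, hβ, hη, hηβ, hs, hpar⟩ :=
    exists_rateSlack Z (by linarith : 0 < δ / 4) (half_pos hδ) (Fintype.card X * Fintype.card Y)
  obtain ⟨K, hK⟩ := exists_nat_ge (2 * Fintype.card X / η ^ 2)
  have hlim := (tendsto_add_one_pow_mul_exp_neg 0 (by positivity : 0 < s * (δ / 8))).add
    ((tendsto_add_one_pow_mul_exp_neg (Fintype.card Y ^ K * (Fintype.card X * Fintype.card Y))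
      (half_pos hδ)).const_mul 2)
  rw [mul_zero, add_zero] at hlim
  simp only [pow_zero, one_mul] at hlim
  filter_upwards [hlim.eventually_lt_const (by positivity : 0 < δ / 4 / (1 + δ)),
    (tendsto_natCast_atTop_atTop.atTop_mul_const
      (by positivity : 0 < δ * (δ / 4))).eventually_ge_atTop (Real.log 2), eventually_ne_atTop 0]
    with n hn hnδ hn0 W hW M N C A B hA hB e he hE
  by_contra! herr
  refine hn.not_ge (sub_le_iff_le_add'.1
    (sub_exp_le_of_forall_blockProbSet_compl_mul_exp_le_one (x := C.cwX)
      (y := C.cwY) (D := C.dec) hpar hβ hη hηβ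
      ((div_le_iff₀ (by positivity)).1 hK) hW (add_pos_of_nonneg_of_pos he hδ)
      (hE.trans_lt ((ENNReal.ofReal_lt_ofReal_iff (by linarith)).2 (by linarith))) hδ hn0
      (hnδ.trans (by gcongr; linarith)) hA hB (fun p q h => C.dec_disjoint _ _ _ _ h)
      fun i hi j hj => ?_))
  have := mul_le_mul_of_nonneg_right (herr i hi j hj).le
    (Real.exp_pos (n * ((e + δ) * (1 + δ)))).le
  rwa [← Real.exp_add, neg_add_cancel, Real.exp_zero] at this

end MaximalError

/-! ### From the maximal to the average error probability -/

section Averaging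

variable {ι κ : Type*} [Fintype κ] {f : ι → κ → ℝ} {θ : ℝ}

theorem card_sub_mul_le_sum_sum (hf : ∀ i j, 0 ≤ f i j) (hθ : 0 ≤ θ) {S : Finset ι} {b : ℝ}
    (h : ∀ B : Finset κ, b ≤ #B → ∃ i ∈ S, ∃ j ∈ B, θ ≤ f i j) :
    (Fintype.card κ - b) * θ ≤ ∑ i ∈ S, ∑ j, f i j := by
  classical
  set B : Finset κ := {j | ∀ i ∈ S, f i j < θ} with hB
  have hBb : (#B : ℝ) < b := by
    by_contra! hle
    obtain ⟨i, hi, j, hj, hθ_le⟩ := h B hle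
    exact hθ_le.not_gt ((mem_filter.1 hj).2 i hi)
  have hcard : (Fintype.card κ : ℝ) - b ≤ #Bᶜ := by
    have hsplit : (#B + #Bᶜ : ℝ) = Fintype.card κ := mod_cast card_add_card_compl B
    linarith
  rw [sum_comm]
  calc (Fintype.card κ - b) * θ ≤ #Bᶜ • θ := by
        rw [nsmul_eq_mul]
        exact mul_le_mul_of_nonneg_right hcard hθ
    _ ≤ ∑ j ∈ Bᶜ, ∑ i ∈ S, f i j := by
        refine card_nsmul_le_sum _ _ _ fun j hj => ?_
        simp only [hB, mem_compl, mem_filter, mem_univ, true_and, not_forall, not_lt] at hj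
        obtain ⟨i, hi, hθ_le⟩ := hj
        exact hθ_le.trans (single_le_sum (f := fun i => f i j) (fun i _ => hf i j) hi)
    _ ≤ ∑ j, ∑ i ∈ S, f i j :=
        sum_le_sum_of_subset_of_nonneg (subset_univ _) fun j _ _ => sum_nonneg fun i _ => hf i j

variable [Fintype ι]

theorem card_div_mul_le_sum_sum (hf : ∀ i j, 0 ≤ f i j) (hθ : 0 ≤ θ) {a : ℕ} {b : ℝ}
    (h : ∀ (S : Finset ι) (B : Finset κ), a ≤ #S → b ≤ #B → ∃ i ∈ S, ∃ j ∈ B, θ ≤ f i j) :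
    ((Fintype.card ι / a : ℕ) : ℝ) * ((Fintype.card κ - b) * θ) ≤ ∑ i, ∑ j, f i j := by
  classical
  set k := Fintype.card ι / a
  rcases eq_or_ne k 0 with hk | hk
  · rw [hk, Nat.cast_zero, zero_mul]
    exact sum_nonneg fun i _ => sum_nonneg fun j _ => hf i j
  obtain ⟨P, hP, hPk⟩ := Finpartition.exists_equipartition_card_eq (univ : Finset ι) hk
    (Nat.div_le_self _ _)
  have hpart : ∀ S ∈ P.parts, a ≤ #S := fun S hS => by
    refine le_trans ?_ (hP.average_le_card_part hS)
    rw [hPk, card_univ, Nat.le_div_iff_mul_le hk.bot_lt, mul_comm]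
    exact Nat.div_mul_le_self _ _
  calc (k : ℝ) * ((Fintype.card κ - b) * θ) = #P.parts • ((Fintype.card κ - b) * θ) := by
        rw [hPk, nsmul_eq_mul]
    _ ≤ ∑ S ∈ P.parts, ∑ i ∈ S, ∑ j, f i j := card_nsmul_le_sum _ _ _ fun S hS =>
        card_sub_mul_le_sum_sum hf hθ fun B => h S B (hpart S hS)
    _ = ∑ i, ∑ j, f i j :=
        (sum_biUnion (t := id) P.supIndep.pairwiseDisjoint).symm.trans
          (congrArg (fun S => ∑ i ∈ S, ∑ j, f i j) P.biUnion_parts)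

theorem card_mul_card_mul_le_sum_sum (hf : ∀ i j, 0 ≤ f i j) (hθ : 0 ≤ θ) {a : ℕ} (ha : 0 < a)
    (ha_le : a ≤ Fintype.card ι) {b : ℝ} (hb : 2 * b ≤ Fintype.card κ)
    (h : ∀ (S : Finset ι) (B : Finset κ), a ≤ #S → b ≤ #B → ∃ i ∈ S, ∃ j ∈ B, θ ≤ f i j) :
    (Fintype.card ι * Fintype.card κ : ℝ) * θ ≤ 4 * a * ∑ i, ∑ j, f i j := by
  have hsum := card_div_mul_le_sum_sum hf hθ h
  set k := Fintype.card ι / a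
  have hι : (Fintype.card ι : ℝ) ≤ 2 * a * k := by
    have hlt : Fintype.card ι < a * (k + 1) := Nat.lt_mul_div_succ _ ha
    have hk : 1 ≤ k := (Nat.one_le_div_iff ha).2 ha_le
    have : Fintype.card ι ≤ 2 * a * k := by nlinarith
    exact_mod_cast this
  have hκ : (Fintype.card κ : ℝ) ≤ 2 * (Fintype.card κ - b) := by linarith
  calc (Fintype.card ι * Fintype.card κ : ℝ) * θ
      ≤ 2 * a * k * (2 * (Fintype.card κ - b)) * θ := by gcongr
    _ = 4 * a * (k * ((Fintype.card κ - b) * θ)) := by ring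
    _ ≤ 4 * a * ∑ i, ∑ j, f i j := by gcongr

end Averaging

section AverageError

theorem ceil_exp_le_two_mul_exp {x : ℝ} (hx : 0 ≤ x) : (⌈Real.exp x⌉₊ : ℝ) ≤ 2 * Real.exp x := by
  linarith [Nat.ceil_lt_add_one (Real.exp_pos x).le, Real.one_le_exp hx]

theorem two_mul_ceil_mul_exp_le {n : ℕ} {R δ ε e : ℝ} (hR : 0 ≤ R) (he : 0 ≤ e) (hε : 0 ≤ ε)
    (hεδ : ε ≤ δ) (hε1 : ε ≤ 1) (hεR : 6 * ε ≤ R * δ) (hn : 4 ≤ Real.exp (n * (R * δ / 2))) :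
    2 * ⌈Real.exp (n * (R + ε))⌉₊ * Real.exp (-(n * (e + R) * (1 + δ))) ≤
      Real.exp (-(n * ((e + ε) * (1 + ε)))) := by
  have hexponent : R * δ / 2 + (R + ε) - (e + R) * (1 + δ) ≤ -((e + ε) * (1 + ε)) := by nlinarith
  calc 2 * ⌈Real.exp (n * (R + ε))⌉₊ * Real.exp (-(n * (e + R) * (1 + δ)))
      ≤ 2 * (2 * Real.exp (n * (R + ε))) * Real.exp (-(n * (e + R) * (1 + δ))) := by
        gcongr
        exact ceil_exp_le_two_mul_exp (by positivity)
    _ = 4 * Real.exp (n * (R + ε)) * Real.exp (-(n * (e + R) * (1 + δ))) := by ring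
    _ ≤ Real.exp (n * (R * δ / 2)) * Real.exp (n * (R + ε)) *
        Real.exp (-(n * (e + R) * (1 + δ))) := by gcongr
    _ = Real.exp (n * (R * δ / 2 + (R + ε) - (e + R) * (1 + δ))) := by
        rw [← Real.exp_add, ← Real.exp_add]
        ring_nf
    _ ≤ Real.exp (-(n * ((e + ε) * (1 + ε)))) := by
        rw [← mul_neg]
        gcongr

theorem half_exp_le_mean {ι κ : Type*} [Fintype ι] [Fintype κ] {n : ℕ} {R S δ ε e : ℝ}
    {f : ι → κ → ℝ} (hf : ∀ i j, 0 ≤ f i j) (hR : 0 ≤ R) (he : 0 ≤ e) (hε : 0 ≤ ε)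
    (hεδ : ε ≤ δ) (hε1 : ε ≤ 1) (hεR : 6 * ε ≤ R * δ) (hnδ : 2 ≤ Real.exp (n * (δ - ε)))
    (hnR : 4 ≤ Real.exp (n * (R * δ / 2))) (hι : Real.exp (n * (R + δ)) ≤ Fintype.card ι)
    (hκ : Real.exp (n * (S + δ)) ≤ Fintype.card κ)
    (h : ∀ (A : Finset ι) (B : Finset κ), Real.exp (n * (R + ε)) ≤ #A →
      Real.exp (n * (S + ε)) ≤ #B →
        ∃ i ∈ A, ∃ j ∈ B, Real.exp (-(n * ((e + ε) * (1 + ε)))) ≤ f i j) :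
    1 / 2 * Real.exp (-(n * (e + R) * (1 + δ))) ≤
      1 / ((Fintype.card ι : ℝ) * Fintype.card κ) * ∑ i, ∑ j, f i j := by
  have hlarge : ∀ T, 2 * Real.exp (n * (T + ε)) ≤ Real.exp (n * (T + δ)) := fun T => by
    rw [show n * (T + δ) = n * (δ - ε) + n * (T + ε) by ring, Real.exp_add]
    gcongr
  have hι0 : (0 : ℝ) < Fintype.card ι := (Real.exp_pos _).trans_le hι
  have hκ0 : (0 : ℝ) < Fintype.card κ := (Real.exp_pos _).trans_le hκ
  set a := ⌈Real.exp (n * (R + ε))⌉₊ with ha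
  have ha0 : 0 < a := Nat.ceil_pos.2 (Real.exp_pos _)
  have ha_le : a ≤ Fintype.card ι :=
    Nat.ceil_le.2 (by linarith [hlarge R, Real.exp_pos (n * (R + ε))])
  have hsum := card_mul_card_mul_le_sum_sum hf (Real.exp_pos _).le ha0 ha_le
    ((hlarge S).trans hκ) fun A B hA => h A B (Nat.ceil_le.1 hA)
  have hrate := two_mul_ceil_mul_exp_le hR he hε hεδ hε1 hεR hnR
  rw [← ha] at hrate
  rw [one_div_mul_eq_div (_ * _), le_div_iff₀ (by positivity)]
  refine le_of_mul_le_mul_left ?_ (by positivity : (0 : ℝ) < 4 * a)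
  refine le_trans ?_ hsum
  calc 4 * a * (1 / 2 * Real.exp (-(n * (e + R) * (1 + δ))) *
        (Fintype.card ι * Fintype.card κ))
      = Fintype.card ι * Fintype.card κ * (2 * a * Real.exp (-(n * (e + R) * (1 + δ)))) := by ring
    _ ≤ Fintype.card ι * Fintype.card κ * Real.exp (-(n * ((e + ε) * (1 + ε)))) := by gcongr

theorem exp_mul_le_of_le_one_div_mul_log {M n : ℕ} {r : ℝ} (hr : 0 < r)
    (h : r ≤ 1 / (n : ℝ) * Real.log M) : Real.exp (n * r) ≤ M := by
  have hpos := hr.trans_le h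
  have hlog : 0 < Real.log M := pos_of_mul_pos_right hpos (by positivity)
  have hn : (0 : ℝ) < n := one_div_pos.1 (pos_of_mul_pos_left hpos hlog.le)
  have hM : (0 : ℝ) < M := Nat.cast_pos.2 (Nat.pos_of_ne_zero fun h0 => by simp [h0] at hlog)
  rwa [← Real.le_log_iff_exp_le hM, mul_comm, ← le_div_iff₀ hn, ← one_div_mul_eq_div]

theorem eventually_half_exp_le_avgError (X Y Z : Type*) [Fintype X] [Fintype Y] [Fintype Z]
    [Nonempty X] [Nonempty Y] [Nonempty Z] {RX RY δ : ℝ} (hRX : 0 < RX) (hRY : 0 < RY)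
    (hδ : 0 < δ) :
    ∀ᶠ n : ℕ in atTop, ∀ W : X → Y → Z → ℝ, IsChannel W → ∀ (M N : ℕ) (C : Code X Y Z n M N),
      Real.exp (n * (RX + δ)) ≤ M → Real.exp (n * (RY + δ)) ≤ N → ∀ e : ℝ, 0 ≤ e →
      maxErrorSpherePackingExponent RX RY W ≤ ENNReal.ofReal e →
        1 / 2 * Real.exp (-(n * (e + min RX RY) * (1 + δ))) ≤ C.avgError W := by
  obtain ⟨ε, ⟨⟨⟨hεδ, hε1⟩, hεX⟩, hεY⟩, hε⟩ :=
    (((((eventually_mul_lt_nhdsGT_zero 1 hδ).and (eventually_mul_lt_nhdsGT_zero 1 one_pos)).and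
      (eventually_mul_lt_nhdsGT_zero 6 (mul_pos hRX hδ))).and
      (eventually_mul_lt_nhdsGT_zero 6 (mul_pos hRY hδ))).and self_mem_nhdsWithin).exists
  rw [one_mul] at hεδ hε1
  have hlarge : ∀ (c : ℝ) {b : ℝ}, 0 < b → ∀ᶠ n : ℕ in atTop, c ≤ Real.exp (n * b) :=
    fun c _ hb => (Real.tendsto_exp_atTop.comp
      (tendsto_natCast_atTop_atTop.atTop_mul_const hb)).eventually_ge_atTop c
  filter_upwards [eventually_exists_exp_le_blockProbSet_compl X Y Z RX RY hε,
    hlarge 2 (sub_pos.2 hεδ), hlarge 4 (half_pos (mul_pos hRX hδ)),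
    hlarge 4 (half_pos (mul_pos hRY hδ))] with n hmax hnδ hnX hnY W hW M N C hM hN e he hE
  have hf : ∀ i j, 0 ≤ blockProbSet W (C.cwX i) (C.cwY j) (C.dec i j)ᶜ := fun i j =>
    mass_nonneg (prodProb_nonneg fun t => (hW _ _).1) _
  have hrect := fun A B hA hB => hmax W hW M N C A B hA hB e he hE
  unfold Code.avgError
  rcases min_choice RX RY with hmin | hmin <;> rw [hmin]
  · simpa using half_exp_le_mean hf hRX.le he (le_of_lt hε) hεδ.le hε1.le hεX.le hnδ hnX
      (by simpa using hM) (by simpa using hN) hrect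
  · rw [mul_comm (M : ℝ), sum_comm]
    simpa using half_exp_le_mean (fun j i => hf i j) hRY.le he (le_of_lt hε) hεδ.le hε1.le hεY.le
      hnδ hnY (by simpa using hN) (by simpa using hM) fun B A hB hA => by
        obtain ⟨i, hi, j, hj, hij⟩ := hrect A B hA hB
        exact ⟨j, hj, i, hi, hij⟩

theorem half_exp_le_ofReal {E : ENNReal} {n : ℕ} (hn : 0 < n) {R c p : ℝ} (hc : 0 < c)
    (h : ∀ e : ℝ, 0 ≤ e → E ≤ ENNReal.ofReal e →
      1 / 2 * Real.exp (-(n * (e + R) * c)) ≤ p) :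
    1 / 2 * EReal.exp (-((n : EReal) * ((E : EReal) + (R : EReal)) * (c : EReal))) ≤
      ENNReal.ofReal p := by
  induction E with
  | top =>
    rw [EReal.coe_ennreal_top, EReal.top_add_coe, EReal.mul_top_of_pos (by exact_mod_cast hn),
      EReal.top_mul_of_pos (by exact_mod_cast hc), EReal.neg_top, EReal.exp_bot, mul_zero]
    exact zero_le
  | coe e =>
    have hexp : (n : EReal) * (((e : ENNReal) : EReal) + (R : EReal)) * (c : EReal) =
        ((n * (e + R) * c : ℝ) : EReal) := by
      rw [EReal.coe_nnreal_eq_coe_real, ← EReal.coe_natCast]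
      simp only [EReal.coe_mul, EReal.coe_add]
    rw [hexp, ← EReal.coe_neg, EReal.exp_coe]
    refine le_trans (le_of_eq ?_) (ENNReal.ofReal_le_ofReal (h e e.2 (by simp)))
    rw [ENNReal.ofReal_mul (by norm_num), ENNReal.ofReal_div_of_pos two_pos, ENNReal.ofReal_one,
      ENNReal.ofReal_ofNat]

end AverageError

end MAC

theorem mainTheorem4 {X Y Z : Type*} [Fintype X] [Fintype Y] [Fintype Z]
    [Nonempty X] [Nonempty Y] [Nonempty Z]
    (RX RY δ : ℝ) (hRX : 0 < RX) (hRY : 0 < RY) (hδ : 0 < δ) :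
    ∃ n₀ : ℕ, ∀ W : X → Y → Z → ℝ, MAC.IsChannel W →
      ∀ n : ℕ, n₀ ≤ n → ∀ (MX MY : ℕ) (C : MAC.Code X Y Z n MX MY),
        RX + δ ≤ 1 / (n : ℝ) * Real.log (MX : ℝ) →
        RY + δ ≤ 1 / (n : ℝ) * Real.log (MY : ℝ) →
        1 / 2 * EReal.exp
            (-((n : EReal) *
                ((MAC.maxErrorSpherePackingExponent RX RY W : EReal) + ((min RX RY : ℝ) : EReal)) *
                ((1 + δ : ℝ) : EReal)))
          ≤ ENNReal.ofReal (C.avgError W) := by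
  obtain ⟨n₀, h⟩ := Filter.eventually_atTop.1
    ((MAC.eventually_half_exp_le_avgError X Y Z hRX hRY hδ).and (Filter.eventually_gt_atTop 0))
  refine ⟨n₀, fun W hW n hn MX MY C hX hY => ?_⟩
  obtain ⟨havg, hn0⟩ := h n hn
  exact MAC.half_exp_le_ofReal hn0 (by linarith) <| havg W hW MX MY C
    (MAC.exp_mul_le_of_le_one_div_mul_log (by linarith) hX)
    (MAC.exp_mul_le_of_le_one_div_mul_log (by linarith) hY)
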